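/- Let $\Gamma$ be a finite extensive-form game with perfect recall, with finite player set $N$ and a chance player $c$ having fixed move probabilities. For a player $i$, let $M_i$ index the information sets $I_i^j$, let $A(I_i^j)$ be the set of actions at $I_i^j$, let $W^i$ be the finite set of sequences (sets of moves of player $i$ along some history, including $\emptyset$), and let $\varpi^i_{I_i^j}$ be the sequence leading to $I_i^j$ and $\varpi^i_{I_i^j}a$ its extension by $a\in A(I_i^j)$. Every nonempty sequence is of this last form. A realization plan of $i$ is a function $\gamma^i\ge 0$ on $W^i$ with $\gamma^i(\emptyset)=1$ and $\sum_{a\in A(I_i^j)}\gamma^i(\varpi^i_{I_i^j}a)=\gamma^i(\varpi^i_{I_i^j})$ for all $j\in M_i$. Let $\Lambda^i$ be the set of these and $\Lambda=\prod_{i\in N}\Lambda^i$; $\gamma\in\Lambda$ is positive if all $\gamma^i(\varpi^i)>0$. The realization plan $\gamma^c$ of chance assigns to a sequence of chance moves the product of their probabilities. For a profile $\varpi$ of sequences of all players and chance let $g^i(\varpi)$ be the payoff of $i$ at the terminal history whose moves form $\varpi$, and $0$ if there is none; put $$g^i(\varpi^i,\gamma^{-i})=\sum_{\varpi^{-i}}g^i(\varpi^i,\varpi^{-i})\prod_{p\in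 (N\cup\{c\})\setminus\{i\}}\gamma^p(\varpi^p),\qquad g^i(\tilde\gamma^i,\gamma^{-i})=\sum_{\varpi^i\in W^i}\tilde\gamma^i(\varpi^i)\,g^i(\varpi^i,\gamma^{-i}),$$ $$g^i_m(\varpi^i,\gamma^{-i})=\max\{g^i(\tilde\gamma^i,\gamma^{-i}) : \tilde\gamma^i\in\Lambda^i,\ \tilde\gamma^i(\varpi^i)=1\}.$$ **Definition A.** For $\varepsilon>0$, a positive $\gamma\in\Lambda$ is an $\varepsilon$-sequence-form proper equilibrium (A) if for all $i\in N$ and $\varpi^i,\tilde\varpi^i\in W^i$ with $g^i_m(\varpi^i,\gamma^{-i})<g^i_m(\tilde\varpi^i,\gamma^{-i})$ one has $\gamma^i(\varpi^i)\le\varepsilon\,\gamma^i(\tilde\varpi^i)$. A profile $\gamma^*\in\Lambda$ is a sequence-form proper equilibrium (A) if it is a limit point of a sequence $\gamma(\varepsilon^k)$ of $\varepsilon^k$-sequence-form proper equilibria (A) with $\varepsilon^k>0$ and $\varepsilon^k\to0$. **Definition B.** Let $\kappa_i(\varpi^i)=1+\sum_{j\in M_i:\ \varpi^i\subseteq\varpi^i_{I_i^j}}(|A(I_i^j)|-1)$.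 Let $\mathcal E^i$ consist of all nonempty sets $E\subseteq W^i\setminus\{\emptyset\}$ such that $\{\varpi^i_{I_i^j}a:a\in A(I_i^j)\}\not\subseteq E$ for every $j\in M_i$ and no element of $E$ is properly contained in another one; put $q^i(E)=\sum_{\varpi^i\in E}\kappa_i(\varpi^i)$. For a vector $\delta=(\delta^i_l)$, $i\in N$, $1\le l\le\kappa_i(\emptyset)$, of positive numbers, let $r^i_l(\delta)=\prod_{q=1}^{\kappa_i(\emptyset)-l}\delta^i_q$ and $$\Lambda^i(\delta)=\Big\{\gamma^i\in\Lambda^i : \sum_{\varpi^i\in E}\gamma^i(\varpi^i)\ \ge\ \sum_{q=1}^{q^i(E)}r^i_q(\delta)\ \text{ for all }E\in\mathcal E^i\Big\}.$$ A profile $\gamma$ is a Nash equilibrium of the perturbed sequence-form game $\Gamma_s(\delta)$ if, for every $i\in N$, $\gamma^i$ maximizes $\sum_{j\in M_i}\sum_{a\in A(I_i^j)}\tilde\gamma^i(\varpi^i_{I_i^j}a)\,g^i(\varpi^i_{I_i^j}a,\gamma^{-i})$ over $\tilde\gamma^i\in\Lambda^i(\delta)$. For $\varepsilon>0$, a positive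 $\gamma\in\Lambda$ is an $\varepsilon$-sequence-form proper equilibrium (B) if it is a Nash equilibrium of $\Gamma_s(\delta)$ for some $\delta$ with $0<\delta^i_l\le\varepsilon$ for all $i,l$. A profile $\gamma^*\in\Lambda$ is a sequence-form proper equilibrium (B) if it is the limit of a sequence $\gamma(\varepsilon^k)$ of $\varepsilon^k$-sequence-form proper equilibria (B) with $\varepsilon^k>0$ and $\varepsilon^k\to0$. **Theorem.** A realization plan profile $\gamma^*\in\Lambda$ is a sequence-form proper equilibrium in the sense of Definition A if and only if it is one in the sense of Definition B. -/

import Mathlib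

open Filter Topology

noncomputable section

/-- A finite tree of histories (finite lists of actions, closed under initial segments) together
with the assignment of a mover to every history.  The movers are the elements of `Option N`:
`some i` is the player `i : N` and `none` is the chance player. -/
structure GameTree (N A : Type*) where
  /-- the finite set `H` of histories -/
  hist : Finset (List A)
  nil_mem : [] ∈ hist
  prefix_mem : ∀ (h : List A) (a : A), h ++ [a] ∈ hist → h ∈ hist
  /-- `P(h)`; only its values at nonterminal histories matter -/
  player : List A → Option N

namespace GameTree

variable {N A : Type*} [DecidableEq N] [DecidableEq A] (T : GameTree N A)

/-- `A(h)`, the set of actions available after the history `h`. -/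
def actions (h : List A) : Finset A :=
  (T.hist.biUnion List.toFinset).filter (fun a => h ++ [a] ∈ T.hist)

/-- The set `Z` of terminal histories. -/
def terminal : Finset (List A) := T.hist.filter (fun h => T.actions h = ∅)

/-- The nonterminal histories after which `p` moves. -/
def decisionNodes (p : Option N) : Finset (List A) :=
  T.hist.filter (fun h => (T.actions h).Nonempty ∧ T.player h = p)

end GameTree

/-- A finite extensive-form game with player set `N` and chance. -/
structure ExtensiveGame (N A : Type*) [DecidableEq N] [DecidableEq A] extends GameTree N A where
  /-- `f_c(a | h)` -/
  chance : List A → A → ℝ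
  chance_nonneg : ∀ h ∈ toGameTree.decisionNodes none, ∀ a ∈ toGameTree.actions h, 0 ≤ chance h a
  chance_sum : ∀ h ∈ toGameTree.decisionNodes none, ∑ a ∈ toGameTree.actions h, chance h a = 1
  /-- the information partition of each player -/
  info : ∀ i : N, Finpartition (toGameTree.decisionNodes (some i))
  actions_eq : ∀ i : N, ∀ I ∈ (info i).parts, ∀ h ∈ I, ∀ h' ∈ I,
    toGameTree.actions h = toGameTree.actions h'
  /-- the payoffs `u_z^i(h)`; only the values at terminal histories matter -/
  payoff : N → List A → ℝ

/-- A finite set of moves.  A move is a pair (information set, action chosen there), so that equal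
labels at different information sets are kept apart. -/
abbrev MoveSet (A : Type*) := Finset (Finset (List A) × A)

/-- A real function on sequences, for every player. -/
abbrev PlanProfile (N A : Type*) := N → MoveSet A → ℝ

namespace ExtensiveGame

variable {N A : Type*} [DecidableEq N] [DecidableEq A] (G : ExtensiveGame N A)

/-- The information partition of a mover; chance observes everything. -/
def infoPartition : (p : Option N) → Finpartition (G.decisionNodes p)
  | some i => G.info i
  | none => ⊥

/-- The collection of information sets of a mover. -/
def infoSets (p : Option N) : Finset (Finset (List A)) := (G.infoPartition p).parts

/-- The information set that contains the nonterminal history `h`. -/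
def infoAt (h : List A) : Finset (List A) := (G.infoPartition (G.player h)).part h

/-- `A(I)`: the common action set of the histories in `I`. -/
def infoActions (I : Finset (List A)) : Finset A := I.biUnion G.actions

/-- The record of the mover `p` along the history `h`: the information sets of `p` that are passed
and the actions taken there, in chronological order. -/
def record (p : Option N) (h : List A) : List (Finset (List A) × A) :=
  (List.range h.length).filterMap fun k =>
    if G.player (h.take k) = p then (h[k]?).map fun a => (G.infoAt (h.take k), a) else none

/-- Perfect recall: histories in the same information set of a player give this player the same
record. -/
def PerfectRecall : Prop :=
  ∀ i : N, ∀ I ∈ G.infoSets (some i), ∀ h ∈ I, ∀ h' ∈ I,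
    G.record (some i) h = G.record (some i) h'

/-! ### Sequences -/

/-- `ϖ^p_h`: the sequence of `p` that is defined by the history `h`. -/
def seqOf (p : Option N) (h : List A) : MoveSet A := (G.record p h).toFinset

/-- `W^p`: the set of sequences of `p`; it contains the empty sequence `∅`. -/
def seqs (p : Option N) : Finset (MoveSet A) := G.hist.image (G.seqOf p)

/-- `ϖ^p_I`: the sequence of `p` leading to the information set `I`; by perfect recall all
histories in `I` define the same sequence. -/
def seqTo (p : Option N) (I : Finset (List A)) : MoveSet A := I.biUnion (G.seqOf p)

/-- `ϖ^p_I a`: the extension by `a` of the sequence leading to `I`. -/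
def seqExt (p : Option N) (I : Finset (List A)) (a : A) : MoveSet A :=
  insert (I, a) (G.seqTo p I)

/-! ### Realization plans and payoffs -/

/-- `Λ^i`: the realization plans of player `i`.  A function on `W^i` is represented by its
extension by zero. -/
def plans (i : N) : Set (MoveSet A → ℝ) :=
  {x | x ∅ = 1 ∧
    (∀ I ∈ G.infoSets (some i),
      ∑ a ∈ G.infoActions I, x (G.seqExt (some i) I a) = x (G.seqTo (some i) I)) ∧
    (∀ I ∈ G.infoSets (some i), ∀ a ∈ G.infoActions I, 0 ≤ x (G.seqExt (some i) I a)) ∧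
    ∀ w, w ∉ G.seqs (some i) → x w = 0}

/-- `Λ`: the realization plan profiles. -/
def planProfiles : Set (PlanProfile N A) := {γ | ∀ i, γ i ∈ G.plans i}

/-- A profile that is positive at every sequence of every player. -/
def IsPositive (γ : PlanProfile N A) : Prop := ∀ i, ∀ w ∈ G.seqs (some i), 0 < γ i w

/-- The fixed realization plan of chance: the product of the probabilities of the chance moves
in `w`. -/
def chancePlan (w : MoveSet A) : ℝ :=
  ∏ h ∈ G.decisionNodes none, ∏ a ∈ (G.actions h).filter (fun a => ({h}, a) ∈ w), G.chance h a

/-- The realization plan of a mover in the profile `γ`. -/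
def planOf (γ : PlanProfile N A) : Option N → MoveSet A → ℝ
  | some i => γ i
  | none => G.chancePlan

variable [Fintype N]

/-- `g^i(ϖ)` for a profile `ϖ` of sequences: the payoff at the terminal history that defines `ϖ`
(there is at most one), and `0` if there is none. -/
def seqPayoff (i : N) (w : Option N → MoveSet A) : ℝ :=
  ∑ h ∈ G.terminal.filter (fun h => ∀ p, w p = G.seqOf p h), G.payoff i h

/-- `g^i(ϖ^i, γ^{-i})`: the expected payoff of player `i` at the sequence `v`; the sum runs over
the profiles of sequences whose `i`-th entry is `v`. -/
def payoffAt (i : N) (v : MoveSet A) (γ : PlanProfile N A) : ℝ :=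
  ∑ w ∈ Fintype.piFinset (fun p : Option N => if p = some i then {v} else G.seqs p),
    G.seqPayoff i w * ∏ p ∈ Finset.univ.erase (some i), G.planOf γ p (w p)

/-- `g^i(x, γ^{-i})`: the expected payoff of player `i` from the plan `x` against `γ`. -/
def expectedPayoff (i : N) (x : MoveSet A → ℝ) (γ : PlanProfile N A) : ℝ :=
  ∑ w ∈ G.seqs (some i), x w * G.payoffAt i w γ

/-- `g^i_m(ϖ^i, γ^{-i})`: the maximal payoff of player `i` against `γ` over the realization plans
that play the sequence `v` with probability one. -/
def maxPayoff (i : N) (v : MoveSet A) (γ : PlanProfile N A) : ℝ :=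
  sSup ((fun x => G.expectedPayoff i x γ) '' {x | x ∈ G.plans i ∧ x v = 1})

/-! ### Proper equilibrium through ratio inequalities -/

/-- `ε`-sequence-form proper equilibrium, ratio form. -/
def IsEpsProperRatio (ε : ℝ) (γ : PlanProfile N A) : Prop :=
  γ ∈ G.planProfiles ∧ G.IsPositive γ ∧
    ∀ i, ∀ v ∈ G.seqs (some i), ∀ w ∈ G.seqs (some i),
      G.maxPayoff i v γ < G.maxPayoff i w γ → γ i v ≤ ε * γ i w

/-- Sequence-form proper equilibrium, ratio form. -/
def IsProperRatio (γ : PlanProfile N A) : Prop :=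
  γ ∈ G.planProfiles ∧ ∃ (ε : ℕ → ℝ) (η : ℕ → PlanProfile N A),
    (∀ k, 0 < ε k) ∧ Tendsto ε atTop (𝓝 0) ∧ (∀ k, G.IsEpsProperRatio (ε k) (η k)) ∧
      MapClusterPt γ atTop η

/-! ### Proper equilibrium through perturbed games -/

/-- `κ_i(ϖ)`: one plus the number of free realization variables at the information sets of player
`i` that are reached through the sequence `w`. -/
def kappa (i : N) (w : MoveSet A) : ℕ :=
  (∑ I ∈ (G.infoSets (some i)).filter (fun I => w ⊆ G.seqTo (some i) I),
    ((G.infoActions I).card - 1)) + 1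

/-- `r^i_l(δ)` for `1 ≤ l ≤ κ_i(∅)`, where `d` is the vector `δ^i`. -/
def perturb (i : N) (d : ℕ → ℝ) (l : ℕ) : ℝ := ∏ q ∈ Finset.Icc 1 (G.kappa i ∅ - l), d q

/-- The family `𝓔^i`: nonempty sets of nonempty sequences that do not contain all the extensions
at any information set, and in which no sequence is properly contained in another one. -/
def IsAdmissible (i : N) (E : Finset (MoveSet A)) : Prop :=
  E ⊆ G.seqs (some i) ∧ E.Nonempty ∧ ∅ ∉ E ∧
    (∀ I ∈ G.infoSets (some i), ¬ (G.infoActions I).image (G.seqExt (some i) I) ⊆ E) ∧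
    ∀ v ∈ E, ∀ w ∈ E, ¬ w ⊂ v

/-- `q^i(E)` -/
def weight (i : N) (E : Finset (MoveSet A)) : ℕ := ∑ w ∈ E, G.kappa i w

/-- `Λ^i(δ)`: the perturbed strategy space of player `i`. -/
def perturbedPlans (i : N) (d : ℕ → ℝ) : Set (MoveSet A → ℝ) :=
  {x | x ∈ G.plans i ∧ ∀ E, G.IsAdmissible i E →
    ∑ q ∈ Finset.Icc 1 (G.weight i E), G.perturb i d q ≤ ∑ w ∈ E, x w}

/-- The objective of player `i` in the perturbed game: the expected payoff without the constant
term of the empty sequence. -/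
def objective (i : N) (x : MoveSet A → ℝ) (γ : PlanProfile N A) : ℝ :=
  ∑ I ∈ G.infoSets (some i), ∑ a ∈ G.infoActions I,
    x (G.seqExt (some i) I a) * G.payoffAt i (G.seqExt (some i) I a) γ

/-- Nash equilibrium of the perturbed game `Γ_s(δ)`. -/
def IsPerturbedNash (δ : N → ℕ → ℝ) (γ : PlanProfile N A) : Prop :=
  ∀ i, γ i ∈ G.perturbedPlans i (δ i) ∧
    ∀ x ∈ G.perturbedPlans i (δ i), G.objective i x γ ≤ G.objective i (γ i) γ

/-- `ε`-sequence-form proper equilibrium, perturbed-game form. -/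
def IsEpsProperPerturbed (ε : ℝ) (γ : PlanProfile N A) : Prop :=
  γ ∈ G.planProfiles ∧ G.IsPositive γ ∧ ∃ δ : N → ℕ → ℝ,
    (∀ i, ∀ l ∈ Finset.Icc 1 (G.kappa i ∅), 0 < δ i l ∧ δ i l ≤ ε) ∧ G.IsPerturbedNash δ γ

/-- Sequence-form proper equilibrium, perturbed-game form. -/
def IsProperPerturbed (γ : PlanProfile N A) : Prop :=
  γ ∈ G.planProfiles ∧ ∃ (ε : ℕ → ℝ) (η : ℕ → PlanProfile N A),
    (∀ k, 0 < ε k) ∧ Tendsto ε atTop (𝓝 0) ∧ (∀ k, G.IsEpsProperPerturbed (ε k) (η k)) ∧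
      Tendsto η atTop (𝓝 γ)

end ExtensiveGame

end

/-! Fix player `i` and the opponents' plans. Backward induction gives each move a loss `ℓ ≥ 0`, with
a lossless action at every information set, such that the payoff of a plan is a constant minus its
expected loss, and the best payoff after playing a sequence `w` is a constant minus the total loss
`L(w)` along `w` (`exists_loss_payoff`). Definition A thus reads: `L(w) < L(v)` implies `x v ≤ ε * x
w`.

For a level `t`, let `C_t` be the set of minimal sequences with `L ≥ t`. The expected loss is `∑ c_t
x(C_t)` over the attained levels, where `c_t` is the gap to the preceding level
(`exists_cut_coefficients`). For attained `t > 0` the cut `C_t` is admissible, and any admissible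
set of sequences with losses at least `t` either has smaller weight or contains `C_t` with equal
weight (`weight_lt_or_cut_subset`). Let `S(q) = r_1 + ... + r_q` be the lower bound imposed on sets
of weight `q`; it grows rapidly in `q` when `δ` is small. The cuts are then the constraints that
decide optimality.

A implies B (`exists_perturbation_of_ratio`): for a plan with sharply decreasing probabilities, `δ`
can be interpolated so that `S(q(C_t)) = x(C_t)` at each positive level. The other constraints
follow from maximality of the cuts, and `x` is optimal because each term `c_t x(C_t)` is at its
minimum.

B implies A: an explicit mixture of plans is feasible and attains the bound in every cut
simultaneously, so every optimal plan has `x(C_t) = S(q(C_t))` (`sum_cut_eq_of_optimal`). If `L(w) <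
t = L(v)`, then `x v ≤ x(C_t) = S(n)` with `n = q(C_t)`, while enlarging the cut by `w` or an
initial part of it raises the weight and yields `r_{n+1} ≤ x w + S(n)`. As `S(n)` is small compared
with `r_{n+1}`, the ratio bound follows (`ratio_of_optimal`). -/

noncomputable section

/-! ### Histories, and the moves recorded along them. -/

namespace GameTree

variable {N A : Type*} (T : GameTree N A)

lemma mem_hist_of_initial {h h' : List A} (hp : h' <+: h) (hh : h ∈ T.hist) : h' ∈ T.hist := by
  induction h using List.reverseRecOn with
  | nil => rw [List.prefix_nil.1 hp]; exact hh
  | append_singleton l a ih =>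
    rcases List.prefix_concat_iff.1 hp with rfl | hp
    · exact hh
    · exact ih hp (T.prefix_mem _ _ hh)

lemma mem_actions [DecidableEq A] {h : List A} {a : A} : a ∈ T.actions h ↔ h ++ [a] ∈ T.hist := by
  constructor
  · intro ha
    exact (Finset.mem_filter.1 ha).2
  · intro ha
    refine Finset.mem_filter.2 ⟨Finset.mem_biUnion.2 ⟨_, ha, ?_⟩, ha⟩
    simp

end GameTree

namespace ExtensiveGame

variable {N A : Type*} [DecidableEq N] [DecidableEq A] {G : ExtensiveGame N A}

section Records

lemma record_concat (p : Option N) (h : List A) (a : A) :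
    G.record p (h ++ [a]) =
      G.record p h ++ (if G.player h = p then [(G.infoAt h, a)] else []) := by
  unfold record
  rw [List.length_append, List.length_singleton, List.range_succ, List.filterMap_append]
  congr 1
  · apply List.filterMap_congr
    intro k hk
    have hk : k < h.length := List.mem_range.1 hk
    rw [List.take_append_of_le_length hk.le, List.getElem?_append_left hk]
  · by_cases hp : G.player h = p <;> simp [hp]

lemma record_initial (p : Option N) {h h' : List A} (hp : h' <+: h) :
    G.record p h' <+: G.record p h := by
  induction h using List.reverseRecOn with
  | nil => rw [List.prefix_nil.1 hp]
  | append_singleton l a ih =>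
    rcases List.prefix_concat_iff.1 hp with rfl | hp
    · exact List.prefix_refl _
    · rw [record_concat]
      exact (ih hp).trans (List.prefix_append _ _)

lemma mem_record {p : Option N} {h : List A} {m : Finset (List A) × A} :
    m ∈ G.record p h ↔ ∃ h' a, h' ++ [a] <+: h ∧ G.player h' = p ∧ m = (G.infoAt h', a) := by
  induction h using List.reverseRecOn with
  | nil => simp [record]
  | append_singleton l a ih =>
    rw [record_concat, List.mem_append, ih]
    constructor
    · rintro (⟨h', b, h1, h2, h3⟩ | hm)
      · exact ⟨h', b, h1.trans (List.prefix_append _ _), h2, h3⟩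
      · split_ifs at hm with hp
        · exact ⟨l, a, List.prefix_refl _, hp, by simpa using hm⟩
        · simp at hm
    · rintro ⟨h', b, h1, h2, rfl⟩
      rcases List.prefix_concat_iff.1 h1 with h1 | h1
      · obtain ⟨rfl, hb⟩ := List.append_inj' h1 rfl
        obtain rfl : b = a := by simpa using hb
        right
        simp [h2]
      · exact Or.inl ⟨h', b, h1, h2, rfl⟩

lemma mem_seqOf {p : Option N} {h : List A} {m : Finset (List A) × A} :
    m ∈ G.seqOf p h ↔ ∃ h' a, h' ++ [a] <+: h ∧ G.player h' = p ∧ m = (G.infoAt h', a) := by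
  rw [seqOf, List.mem_toFinset, mem_record]

lemma seqOf_concat_of_eq {p : Option N} {h : List A} (hp : G.player h = p) (a : A) :
    G.seqOf p (h ++ [a]) = insert (G.infoAt h, a) (G.seqOf p h) := by
  ext m
  simp [seqOf, record_concat, hp, or_comm]

lemma seqOf_concat_of_ne {p : Option N} {h : List A} (hp : G.player h ≠ p) (a : A) :
    G.seqOf p (h ++ [a]) = G.seqOf p h := by
  ext m
  simp [seqOf, record_concat, hp]

lemma seqOf_mono (p : Option N) {h h' : List A} (hp : h' <+: h) :
    G.seqOf p h' ⊆ G.seqOf p h := by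
  intro m hm
  rw [seqOf, List.mem_toFinset] at hm ⊢
  exact (record_initial p hp).subset hm

end Records

/-! ### The tree structure of the sequences of one player under perfect recall. -/

section InfoSets

variable {i : N}

lemma infoAt_eq_part {h : List A} (hp : G.player h = some i) :
    G.infoAt h = (G.info i).part h := by
  unfold infoAt
  rw [hp]
  rfl

lemma mem_decisionNodes_of_concat {h : List A} {a : A} (hh : h ++ [a] ∈ G.hist)
    (hp : G.player h = some i) : h ∈ G.decisionNodes (some i) :=
  Finset.mem_filter.2 ⟨G.prefix_mem _ _ hh, ⟨a, G.mem_actions.2 hh⟩, hp⟩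

lemma infoAt_mem {h : List A} (hh : h ∈ G.decisionNodes (some i)) :
    G.infoAt h ∈ G.infoSets (some i) := by
  rw [infoAt_eq_part (Finset.mem_filter.1 hh).2.2]
  exact (G.info i).part_mem.2 hh

lemma mem_infoAt {h : List A} (hh : h ∈ G.decisionNodes (some i)) : h ∈ G.infoAt h := by
  rw [infoAt_eq_part (Finset.mem_filter.1 hh).2.2]
  exact (G.info i).mem_part hh

lemma mem_decisionNodes {I : Finset (List A)} (hI : I ∈ G.infoSets (some i)) {h : List A}
    (hh : h ∈ I) : h ∈ G.decisionNodes (some i) :=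
  (G.info i).le hI hh

lemma infoAt_eq {I : Finset (List A)} (hI : I ∈ G.infoSets (some i)) {h : List A}
    (hh : h ∈ I) : G.infoAt h = I := by
  rw [infoAt_eq_part (Finset.mem_filter.1 (mem_decisionNodes hI hh)).2.2]
  exact (G.info i).part_eq_of_mem hI hh

lemma infoSet_nonempty {I : Finset (List A)} (hI : I ∈ G.infoSets (some i)) : I.Nonempty :=
  (G.info i).nonempty_of_mem_parts hI

lemma player_eq {I : Finset (List A)} (hI : I ∈ G.infoSets (some i)) {h : List A}
    (hh : h ∈ I) : G.player h = some i :=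
  (Finset.mem_filter.1 (mem_decisionNodes hI hh)).2.2

lemma infoActions_nonempty {I : Finset (List A)} (hI : I ∈ G.infoSets (some i)) :
    (G.infoActions I).Nonempty := by
  obtain ⟨h, hh⟩ := infoSet_nonempty hI
  obtain ⟨a, ha⟩ := (Finset.mem_filter.1 (mem_decisionNodes hI hh)).2.1
  exact ⟨a, Finset.mem_biUnion.2 ⟨h, hh, ha⟩⟩

lemma seqTo_eq (hG : G.PerfectRecall) {I : Finset (List A)} (hI : I ∈ G.infoSets (some i))
    {h : List A} (hh : h ∈ I) : G.seqTo (some i) I = G.seqOf (some i) h := by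
  ext m
  simp only [seqTo, Finset.mem_biUnion]
  constructor
  · rintro ⟨h', hh', hm⟩
    rw [seqOf, hG i I hI h hh h' hh']
    exact hm
  · exact fun hm => ⟨h, hh, hm⟩

/-- The moves in the sequence of a history are (information set, action) pairs, and the
sequence up to and including such a move is the corresponding extension. -/
lemma exists_of_mem_seqOf (hG : G.PerfectRecall) {h : List A} (hh : h ∈ G.hist)
    {m : Finset (List A) × A} (hm : m ∈ G.seqOf (some i) h) :
    ∃ h' a, h' ++ [a] <+: h ∧ h' ∈ m.1 ∧ a = m.2 ∧ m.1 ∈ G.infoSets (some i) ∧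
      m.2 ∈ G.infoActions m.1 ∧ G.seqTo (some i) m.1 = G.seqOf (some i) h' ∧
      G.seqExt (some i) m.1 m.2 = G.seqOf (some i) (h' ++ [a]) := by
  obtain ⟨h', a, hpre, hp, rfl⟩ := mem_seqOf.1 hm
  have hha : h' ++ [a] ∈ G.hist := G.mem_hist_of_initial hpre hh
  have hd := mem_decisionNodes_of_concat hha hp
  have hs := seqTo_eq hG (infoAt_mem hd) (mem_infoAt hd)
  refine ⟨h', a, hpre, mem_infoAt hd, rfl, infoAt_mem hd,
    Finset.mem_biUnion.2 ⟨h', mem_infoAt hd, G.mem_actions.2 hha⟩, hs, ?_⟩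
  rw [seqOf_concat_of_eq hp, seqExt, hs]

/-- Otherwise a history in `I` would properly extend another one in `I`, and its record would be
strictly longer, against perfect recall. -/
lemma notMem_seqTo (hG : G.PerfectRecall) {I : Finset (List A)}
    (hI : I ∈ G.infoSets (some i)) (a : A) : (I, a) ∉ G.seqTo (some i) I := by
  obtain ⟨h, hh⟩ := infoSet_nonempty hI
  rw [seqTo_eq hG hI hh]
  intro hm
  obtain ⟨h', b, hpre, hh', -⟩ :=
    exists_of_mem_seqOf hG (Finset.mem_filter.1 (mem_decisionNodes hI hh)).1 hm
  have h1 := (record_initial (G := G) (some i) hpre).length_le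
  rw [record_concat, if_pos (player_eq hI hh'), hG i I hI h' hh' h hh, List.length_append] at h1
  simp at h1

lemma card_seqExt (hG : G.PerfectRecall) {I : Finset (List A)}
    (hI : I ∈ G.infoSets (some i)) (a : A) :
    (G.seqExt (some i) I a).card = (G.seqTo (some i) I).card + 1 :=
  Finset.card_insert_of_notMem (notMem_seqTo hG hI a)

lemma seqTo_ssubset_seqExt (hG : G.PerfectRecall) {I : Finset (List A)}
    (hI : I ∈ G.infoSets (some i)) (a : A) :
    G.seqTo (some i) I ⊂ G.seqExt (some i) I a :=
  Finset.ssubset_insert (notMem_seqTo hG hI a)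

lemma seqTo_mem_seqs (hG : G.PerfectRecall) {I : Finset (List A)}
    (hI : I ∈ G.infoSets (some i)) : G.seqTo (some i) I ∈ G.seqs (some i) := by
  obtain ⟨h, hh⟩ := infoSet_nonempty hI
  rw [seqTo_eq hG hI hh]
  exact Finset.mem_image_of_mem _ (Finset.mem_filter.1 (mem_decisionNodes hI hh)).1

lemma seqExt_mem_seqs (hG : G.PerfectRecall) {I : Finset (List A)}
    (hI : I ∈ G.infoSets (some i)) {a : A} (ha : a ∈ G.infoActions I) :
    G.seqExt (some i) I a ∈ G.seqs (some i) := by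
  obtain ⟨h, hh, ha⟩ := Finset.mem_biUnion.1 ha
  have : G.seqExt (some i) I a = G.seqOf (some i) (h ++ [a]) := by
    rw [seqOf_concat_of_eq (player_eq hI hh), seqExt, seqTo_eq hG hI hh, infoAt_eq hI hh]
  rw [this]
  exact Finset.mem_image_of_mem _ (G.mem_actions.1 ha)

lemma empty_mem_seqs : ∅ ∈ G.seqs (some i) :=
  Finset.mem_image.2 ⟨[], G.nil_mem, by simp [seqOf, record]⟩

lemma seqExt_ne_empty (I : Finset (List A)) (a : A) : G.seqExt (some i) I a ≠ ∅ :=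
  Finset.insert_ne_empty _ _

lemma mem_seqExt_self (I : Finset (List A)) (a : A) : (I, a) ∈ G.seqExt (some i) I a :=
  Finset.mem_insert_self _ _

lemma mem_of_mem_seqs (hG : G.PerfectRecall) {w : MoveSet A} (hw : w ∈ G.seqs (some i))
    {m : Finset (List A) × A} (hm : m ∈ w) :
    m.1 ∈ G.infoSets (some i) ∧ m.2 ∈ G.infoActions m.1 ∧ G.seqExt (some i) m.1 m.2 ⊆ w := by
  obtain ⟨h, hh, rfl⟩ := Finset.mem_image.1 hw
  obtain ⟨h', a, hpre, -, -, h1, h2, -, h3⟩ := exists_of_mem_seqOf hG hh hm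
  exact ⟨h1, h2, h3 ▸ seqOf_mono _ hpre⟩

/-- Two moves in the same sequence are comparable. -/
lemma chain_of_mem_seqs (hG : G.PerfectRecall) {w : MoveSet A} (hw : w ∈ G.seqs (some i))
    {m m' : Finset (List A) × A} (hm : m ∈ w) (hm' : m' ∈ w) :
    m ∈ G.seqTo (some i) m'.1 ∨ m = m' ∨ m' ∈ G.seqTo (some i) m.1 := by
  obtain ⟨h, hh, rfl⟩ := Finset.mem_image.1 hw
  obtain ⟨h₁, a, hpre, hm1, ha, h1, h2, h3, h4⟩ := exists_of_mem_seqOf hG hh hm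
  obtain ⟨h₂, b, hpre', hm1', hb, h1', h2', h3', h4'⟩ := exists_of_mem_seqOf hG hh hm'
  rcases lt_trichotomy h₁.length h₂.length with hlt | heq | hlt
  · left
    have : h₁ ++ [a] <+: h₂ := List.prefix_of_prefix_length_le hpre
      ((List.prefix_append h₂ [b]).trans hpre') (by simpa using hlt)
    rw [h3']
    exact seqOf_mono _ this (h4 ▸ mem_seqExt_self _ _)
  · right; left
    have : h₁ ++ [a] = h₂ ++ [b] :=
      (List.prefix_of_prefix_length_le hpre hpre' (by simp [heq])).eq_of_length (by simp [heq])
    obtain ⟨rfl, hab⟩ := List.append_inj' this rfl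
    have hI : m.1 = m'.1 := by rw [← infoAt_eq h1 hm1, ← infoAt_eq h1' hm1']
    exact Prod.ext hI (by rw [← ha, ← hb]; simpa using hab)
  · right; right
    have : h₂ ++ [b] <+: h₁ := List.prefix_of_prefix_length_le hpre'
      ((List.prefix_append h₁ [a]).trans hpre) (by simpa using hlt)
    rw [h3]
    exact seqOf_mono _ this (h4' ▸ mem_seqExt_self _ _)

lemma action_unique (hG : G.PerfectRecall) {w : MoveSet A} (hw : w ∈ G.seqs (some i))
    {I : Finset (List A)} {a b : A} (ha : (I, a) ∈ w) (hb : (I, b) ∈ w) : a = b := by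
  have hI := (mem_of_mem_seqs hG hw ha).1
  rcases chain_of_mem_seqs hG hw ha hb with h | h | h
  · exact absurd h (notMem_seqTo hG hI a)
  · exact congrArg Prod.snd h
  · exact absurd h (notMem_seqTo hG hI b)

lemma seqExt_subset_seqTo (hG : G.PerfectRecall) {I : Finset (List A)}
    (hI : I ∈ G.infoSets (some i)) {m : Finset (List A) × A} (hm : m ∈ G.seqTo (some i) I) :
    G.seqExt (some i) m.1 m.2 ⊆ G.seqTo (some i) I :=
  (mem_of_mem_seqs hG (seqTo_mem_seqs hG hI) hm).2.2

/-- A nonempty sequence determines its last move. This turns sums over nonempty sequences into sums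
over moves. -/
lemma seqExt_inj (hG : G.PerfectRecall) {I J : Finset (List A)}
    (hJ : J ∈ G.infoSets (some i)) {a b : A}
    (h : G.seqExt (some i) I a = G.seqExt (some i) J b) : I = J ∧ a = b := by
  have hm : (I, a) ∈ G.seqExt (some i) J b := h ▸ mem_seqExt_self _ _
  rcases Finset.mem_insert.1 hm with hm | hm
  · exact Prod.ext_iff.1 hm
  · have h1 : G.seqExt (some i) I a ⊆ G.seqTo (some i) J := seqExt_subset_seqTo hG hJ hm
    rw [h] at h1
    exact absurd h1 (seqTo_ssubset_seqExt hG hJ b).not_subset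

/-- Every nonempty sequence extends the sequence leading to an information set. -/
lemma exists_seqExt (hG : G.PerfectRecall) {w : MoveSet A} (hw : w ∈ G.seqs (some i))
    (hne : w ≠ ∅) :
    ∃ I ∈ G.infoSets (some i), ∃ a ∈ G.infoActions I, w = G.seqExt (some i) I a := by
  obtain ⟨h, hh, rfl⟩ := Finset.mem_image.1 hw
  clear hw
  induction h using List.reverseRecOn with
  | nil => simp [seqOf, record] at hne
  | append_singleton l a ih =>
    by_cases hp : G.player l = some i
    · have hd := mem_decisionNodes_of_concat hh hp
      refine ⟨_, infoAt_mem hd, a,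
        Finset.mem_biUnion.2 ⟨l, mem_infoAt hd, G.mem_actions.2 hh⟩, ?_⟩
      rw [seqOf_concat_of_eq hp, seqExt, seqTo_eq hG (infoAt_mem hd) (mem_infoAt hd)]
    · rw [seqOf_concat_of_ne hp] at hne ⊢
      exact ih (G.prefix_mem _ _ hh) hne

lemma seqs_induction (hG : G.PerfectRecall) {P : MoveSet A → Prop} (h0 : P ∅)
    (hs : ∀ I ∈ G.infoSets (some i), ∀ a ∈ G.infoActions I, P (G.seqTo (some i) I) →
      P (G.seqExt (some i) I a)) {w : MoveSet A} (hw : w ∈ G.seqs (some i)) : P w := by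
  induction hn : w.card using Nat.strong_induction_on generalizing w with
  | _ n ih =>
    by_cases hne : w = ∅
    · rw [hne]; exact h0
    · obtain ⟨I, hI, a, ha, rfl⟩ := exists_seqExt hG hw hne
      refine hs I hI a ha (ih _ ?_ (seqTo_mem_seqs hG hI) rfl)
      rw [← hn, card_seqExt hG hI]
      exact Nat.lt_succ_self _

/-- A sequence containing the move `(I, a)` contains everything leading to it, so a proper part of
the extension must miss that move. -/
lemma subset_seqTo_of_ssubset (hG : G.PerfectRecall) {I : Finset (List A)} {a : A}
    {v : MoveSet A} (hv : v ∈ G.seqs (some i)) (hlt : v ⊂ G.seqExt (some i) I a) :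
    v ⊆ G.seqTo (some i) I := by
  intro m hm
  rcases Finset.mem_insert.1 (hlt.1 hm) with rfl | h
  · exact absurd (mem_of_mem_seqs hG hv hm).2.2 hlt.2
  · exact h

/-- The sequences contained in a given sequence form a chain. -/
lemma subset_total (hG : G.PerfectRecall) {u v w : MoveSet A} (hu : u ∈ G.seqs (some i))
    (hv : v ∈ G.seqs (some i)) (hw : w ∈ G.seqs (some i)) (huw : u ⊆ w) (hvw : v ⊆ w) :
    u ⊆ v ∨ v ⊆ u := by
  by_cases hu0 : u = ∅
  · exact Or.inl (hu0 ▸ Finset.empty_subset v)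
  by_cases hv0 : v = ∅
  · exact Or.inr (hv0 ▸ Finset.empty_subset u)
  obtain ⟨I, hI, a, ha, rfl⟩ := exists_seqExt hG hu hu0
  obtain ⟨J, hJ, b, hb, rfl⟩ := exists_seqExt hG hv hv0
  rcases chain_of_mem_seqs hG hw (huw (mem_seqExt_self I a)) (hvw (mem_seqExt_self J b)) with
    h | h | h
  · exact Or.inl ((seqExt_subset_seqTo hG hJ h).trans (seqTo_ssubset_seqExt hG hJ b).1)
  · obtain ⟨rfl, rfl⟩ := Prod.mk.inj h
    exact Or.inl (Finset.Subset.refl _)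
  · exact Or.inr ((seqExt_subset_seqTo hG hI h).trans (seqTo_ssubset_seqExt hG hI a).1)

end InfoSets

/-! ### Elementary properties of realization plans. -/

section Plans

variable {i : N}

lemma plan_nonneg (hG : G.PerfectRecall) {x : MoveSet A → ℝ} (hx : x ∈ G.plans i)
    (w : MoveSet A) : 0 ≤ x w := by
  obtain ⟨h0, -, h2, h3⟩ := hx
  by_cases hw : w ∈ G.seqs (some i)
  · by_cases hne : w = ∅
    · rw [hne, h0]; exact zero_le_one
    · obtain ⟨I, hI, a, ha, rfl⟩ := exists_seqExt hG hw hne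
      exact h2 I hI a ha
  · rw [h3 w hw]

lemma plan_seqExt_le (hG : G.PerfectRecall) {x : MoveSet A → ℝ} (hx : x ∈ G.plans i)
    {I : Finset (List A)} (hI : I ∈ G.infoSets (some i)) {a : A} (ha : a ∈ G.infoActions I) :
    x (G.seqExt (some i) I a) ≤ x (G.seqTo (some i) I) := by
  rw [← hx.2.1 I hI]
  exact Finset.single_le_sum (f := fun a => x (G.seqExt (some i) I a))
    (fun b _ => plan_nonneg hG hx _) ha

lemma plan_anti (hG : G.PerfectRecall) {x : MoveSet A → ℝ} (hx : x ∈ G.plans i)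
    {v w : MoveSet A} (hv : v ∈ G.seqs (some i)) (hw : w ∈ G.seqs (some i)) (hvw : v ⊆ w) :
    x w ≤ x v := by
  revert hvw
  refine seqs_induction hG (P := fun w => v ⊆ w → x w ≤ x v) ?_ ?_ hw
  · intro h
    rw [Finset.subset_empty.1 h]
  · intro I hI a ha ih h
    rcases h.eq_or_ssubset with h | h
    · rw [h]
    · exact (plan_seqExt_le hG hx hI ha).trans (ih (subset_seqTo_of_ssubset hG hv h))

end Plans

end ExtensiveGame

namespace ExtensiveGame

variable {N A : Type*} [DecidableEq N] [DecidableEq A] {G : ExtensiveGame N A} {i : N}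

/-! ### Losses of moves, and payoffs expressed through them. -/

section Losses

variable (G) in
/-- The moves of a player: pairs of an information set and an action there. -/
def moves (i : N) : MoveSet A :=
  (G.infoSets (some i) ×ˢ (G.infoSets (some i)).biUnion G.infoActions).filter
    fun m => m.2 ∈ G.infoActions m.1

lemma mem_moves {m : Finset (List A) × A} :
    m ∈ G.moves i ↔ m.1 ∈ G.infoSets (some i) ∧ m.2 ∈ G.infoActions m.1 := by
  simp only [moves, Finset.mem_filter, Finset.mem_product, Finset.mem_biUnion]
  constructor
  · rintro ⟨⟨h1, -⟩, h2⟩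
    exact ⟨h1, h2⟩
  · rintro ⟨h1, h2⟩
    exact ⟨⟨h1, _, h1, h2⟩, h2⟩

lemma sum_moves (f : Finset (List A) × A → ℝ) :
    ∑ m ∈ G.moves i, f m = ∑ I ∈ G.infoSets (some i), ∑ a ∈ G.infoActions I, f (I, a) :=
  Finset.sum_finset_product _ _ _ fun _ => mem_moves

lemma seqs_eq (hG : G.PerfectRecall) : G.seqs (some i) =
    insert ∅ ((G.moves i).image fun m => G.seqExt (some i) m.1 m.2) := by
  ext w
  rw [Finset.mem_insert, Finset.mem_image]
  constructor
  · intro hw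
    by_cases hne : w = ∅
    · exact Or.inl hne
    · obtain ⟨I, hI, a, ha, rfl⟩ := exists_seqExt hG hw hne
      exact Or.inr ⟨(I, a), mem_moves.2 ⟨hI, ha⟩, rfl⟩
  · rintro (rfl | ⟨m, hm, rfl⟩)
    · exact empty_mem_seqs
    · exact seqExt_mem_seqs hG (mem_moves.1 hm).1 (mem_moves.1 hm).2

lemma sum_seqs (hG : G.PerfectRecall) (f : MoveSet A → ℝ) :
    ∑ w ∈ G.seqs (some i), f w =
      f ∅ + ∑ I ∈ G.infoSets (some i), ∑ a ∈ G.infoActions I, f (G.seqExt (some i) I a) := by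
  rw [seqs_eq hG, Finset.sum_insert, Finset.sum_image, sum_moves]
  · intro m hm m' hm' h
    exact Prod.ext_iff.2 (seqExt_inj hG (mem_moves.1 hm').1 h)
  · simp [seqExt_ne_empty]

variable (G) in
/-- A system of losses: nonnegative, with a lossless action at every information set. -/
def IsLoss (i : N) (ℓ : Finset (List A) × A → ℝ) : Prop :=
  ∀ I ∈ G.infoSets (some i),
    (∀ a ∈ G.infoActions I, 0 ≤ ℓ (I, a)) ∧ ∃ a ∈ G.infoActions I, ℓ (I, a) = 0

variable (G) in
/-- The expected loss of a plan. -/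
def cost (i : N) (ℓ : Finset (List A) × A → ℝ) (x : MoveSet A → ℝ) : ℝ :=
  ∑ m ∈ G.moves i, x (G.seqExt (some i) m.1 m.2) * ℓ m

/-- The total loss along a sequence. -/
def lossOf (ℓ : Finset (List A) × A → ℝ) (w : MoveSet A) : ℝ := ∑ m ∈ w, ℓ m

/-- Backward induction: values of the information sets. -/
lemma exists_value (hG : G.PerfectRecall) (c : MoveSet A → ℝ) :
    ∃ u : Finset (List A) → ℝ, ∀ I (hI : I ∈ G.infoSets (some i)),
      u I = (G.infoActions I).sup' (infoActions_nonempty hI) fun a =>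
        c (G.seqExt (some i) I a) +
          ∑ J ∈ G.infoSets (some i) with G.seqTo (some i) J = G.seqExt (some i) I a, u J := by
  classical
  set D := (G.infoSets (some i)).sup fun I => (G.seqTo (some i) I).card with hD
  -- Recursion from the deepest information sets upwards: at stage `n` the equation holds at all
  -- depths above `D - n`.
  suffices h : ∀ n, ∃ u : Finset (List A) → ℝ, ∀ I (hI : I ∈ G.infoSets (some i)),
      D < (G.seqTo (some i) I).card + n →
      u I = (G.infoActions I).sup' (infoActions_nonempty hI) fun a =>
        c (G.seqExt (some i) I a) +
          ∑ J ∈ G.infoSets (some i) with G.seqTo (some i) J = G.seqExt (some i) I a, u J by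
    obtain ⟨u, hu⟩ := h (D + 1)
    exact ⟨u, fun I hI => hu I hI (by omega)⟩
  intro n
  induction n with
  | zero =>
    refine ⟨0, fun I hI h => absurd h ?_⟩
    rw [add_zero, not_lt]
    exact Finset.le_sup (f := fun I => (G.seqTo (some i) I).card) hI
  | succ n ih =>
    obtain ⟨u, hu⟩ := ih
    refine ⟨fun I => if hI : I ∈ G.infoSets (some i) then
      (G.infoActions I).sup' (infoActions_nonempty hI) fun a =>
        c (G.seqExt (some i) I a) +
          ∑ J ∈ G.infoSets (some i) with G.seqTo (some i) J = G.seqExt (some i) I a, u J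
      else 0, fun I hI hn => ?_⟩
    beta_reduce
    rw [dif_pos hI]
    refine Finset.sup'_congr _ rfl fun a ha => ?_
    congr 1
    refine Finset.sum_congr rfl fun J hJ => ?_
    obtain ⟨hJ, hJe⟩ := Finset.mem_filter.1 hJ
    rw [dif_pos hJ]
    refine hu J hJ ?_
    rw [hJe, card_seqExt hG hI]
    omega

/-- The payoff of a plan is a constant minus its expected loss. -/
lemma exists_loss (hG : G.PerfectRecall) (c : MoveSet A → ℝ) :
    ∃ ℓ, G.IsLoss i ℓ ∧ ∃ K : ℝ, ∀ x ∈ G.plans i,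
      ∑ I ∈ G.infoSets (some i), ∑ a ∈ G.infoActions I,
        x (G.seqExt (some i) I a) * c (G.seqExt (some i) I a) = K - G.cost i ℓ x := by
  obtain ⟨u, hu⟩ := exists_value (i := i) hG c
  set v : MoveSet A → ℝ := fun w => ∑ J ∈ G.infoSets (some i) with G.seqTo (some i) J = w, u J
    with hv
  refine ⟨fun m => u m.1 - (c (G.seqExt (some i) m.1 m.2) + v (G.seqExt (some i) m.1 m.2)),
    fun I hI => ⟨fun a ha => ?_, ?_⟩, v ∅, fun x hx => ?_⟩
  · rw [sub_nonneg, hu I hI]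
    exact Finset.le_sup' (fun a => c (G.seqExt (some i) I a) + v (G.seqExt (some i) I a)) ha
  · obtain ⟨a, ha, h⟩ := Finset.exists_mem_eq_sup' (infoActions_nonempty hI)
      fun a => c (G.seqExt (some i) I a) + v (G.seqExt (some i) I a)
    exact ⟨a, ha, sub_eq_zero.2 ((hu I hI).trans h)⟩
  -- The values telescope: `h1` groups the information sets by the sequence leading to them and `h2`
  -- is conservation of the plan's mass, so only the value `v ∅` at the root survives.
  · have h1 : ∑ w ∈ G.seqs (some i), x w * v w =
        ∑ J ∈ G.infoSets (some i), x (G.seqTo (some i) J) * u J := by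
      rw [← Finset.sum_fiberwise_of_maps_to (t := G.seqs (some i)) (g := G.seqTo (some i))
        (fun J hJ => seqTo_mem_seqs hG hJ)]
      refine Finset.sum_congr rfl fun w _ => ?_
      rw [hv, Finset.mul_sum]
      refine Finset.sum_congr rfl fun J hJ => ?_
      rw [(Finset.mem_filter.1 hJ).2]
    rw [sum_seqs hG, hx.1, one_mul] at h1
    have h2 : ∑ J ∈ G.infoSets (some i), x (G.seqTo (some i) J) * u J =
        ∑ I ∈ G.infoSets (some i), ∑ a ∈ G.infoActions I, x (G.seqExt (some i) I a) * u I := by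
      refine Finset.sum_congr rfl fun J hJ => ?_
      rw [← hx.2.1 J hJ, Finset.sum_mul]
    rw [cost, sum_moves]
    simp only [mul_sub, mul_add, Finset.sum_sub_distrib, Finset.sum_add_distrib]
    linarith

variable {ℓ : Finset (List A) × A → ℝ}

lemma IsLoss.nonneg_of_mem (hℓ : G.IsLoss i ℓ) {m : Finset (List A) × A} (hm : m ∈ G.moves i) :
    0 ≤ ℓ m :=
  (hℓ _ (mem_moves.1 hm).1).1 _ (mem_moves.1 hm).2

lemma subset_moves (hG : G.PerfectRecall) {w : MoveSet A} (hw : w ∈ G.seqs (some i)) :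
    w ⊆ G.moves i :=
  fun _ hm => mem_moves.2 ⟨(mem_of_mem_seqs hG hw hm).1, (mem_of_mem_seqs hG hw hm).2.1⟩

lemma lossOf_empty {A : Type*} {ℓ : Finset (List A) × A → ℝ} : lossOf ℓ ∅ = 0 :=
  Finset.sum_empty

lemma lossOf_seqExt (hG : G.PerfectRecall) {I : Finset (List A)}
    (hI : I ∈ G.infoSets (some i)) (a : A) :
    lossOf ℓ (G.seqExt (some i) I a) = lossOf ℓ (G.seqTo (some i) I) + ℓ (I, a) := by
  rw [lossOf, seqExt, Finset.sum_insert (notMem_seqTo hG hI a), add_comm, lossOf]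

lemma lossOf_mono (hG : G.PerfectRecall) (hℓ : G.IsLoss i ℓ) {v w : MoveSet A}
    (hw : w ∈ G.seqs (some i)) (hvw : v ⊆ w) : lossOf ℓ v ≤ lossOf ℓ w :=
  Finset.sum_le_sum_of_subset_of_nonneg hvw fun _ hm _ =>
    hℓ.nonneg_of_mem (subset_moves hG hw hm)

lemma lossOf_nonneg (hG : G.PerfectRecall) (hℓ : G.IsLoss i ℓ) {w : MoveSet A}
    (hw : w ∈ G.seqs (some i)) : 0 ≤ lossOf ℓ w :=
  lossOf_empty (ℓ := ℓ) ▸ lossOf_mono hG hℓ hw (Finset.empty_subset w)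

/-- Playing `w` with probability one forces probability one on all its initial parts, so every loss
along `w` is incurred in full. -/
lemma lossOf_le_cost (hG : G.PerfectRecall) (hℓ : G.IsLoss i ℓ) {x : MoveSet A → ℝ}
    (hx : x ∈ G.plans i) {w : MoveSet A} (hw : w ∈ G.seqs (some i)) (hxw : x w = 1) :
    lossOf ℓ w ≤ G.cost i ℓ x := by
  calc lossOf ℓ w ≤ ∑ m ∈ w, x (G.seqExt (some i) m.1 m.2) * ℓ m := by
        refine Finset.sum_le_sum fun m hm => ?_
        obtain ⟨h1, h2, h3⟩ := mem_of_mem_seqs hG hw hm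
        have h4 := plan_anti hG hx (seqExt_mem_seqs hG h1 h2) hw h3
        rw [hxw] at h4
        exact le_mul_of_one_le_left (hℓ.nonneg_of_mem (subset_moves hG hw hm)) h4
    _ ≤ _ := Finset.sum_le_sum_of_subset_of_nonneg (subset_moves hG hw) fun m hm _ =>
        mul_nonneg (plan_nonneg hG hx _) (hℓ.nonneg_of_mem hm)

variable (G) in
/-- The realization plan of a pure strategy. -/
def purePlan (i : N) (f : Finset (List A) → A) (w : MoveSet A) : ℝ :=
  if w ∈ G.seqs (some i) ∧ ∀ m ∈ w, m.2 = f m.1 then 1 else 0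

lemma purePlan_seqExt (hG : G.PerfectRecall) (f : Finset (List A) → A) {I : Finset (List A)}
    (hI : I ∈ G.infoSets (some i)) {a : A} (ha : a ∈ G.infoActions I) :
    G.purePlan i f (G.seqExt (some i) I a) =
      if a = f I then G.purePlan i f (G.seqTo (some i) I) else 0 := by
  have h : (∀ m ∈ G.seqExt (some i) I a, m.2 = f m.1) ↔
      a = f I ∧ ∀ m ∈ G.seqTo (some i) I, m.2 = f m.1 := Finset.forall_mem_insert _ _ _
  simp only [purePlan, seqExt_mem_seqs hG hI ha, seqTo_mem_seqs hG hI, true_and, h, ite_and]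

lemma purePlan_mem_plans (hG : G.PerfectRecall) {f : Finset (List A) → A}
    (hf : ∀ I ∈ G.infoSets (some i), f I ∈ G.infoActions I) :
    G.purePlan i f ∈ G.plans i := by
  refine ⟨by simp [purePlan, empty_mem_seqs], fun I hI => ?_, fun I _ a _ => ?_, fun w hw => ?_⟩
  · rw [Finset.sum_congr rfl fun a ha => purePlan_seqExt hG f hI ha,
      Finset.sum_ite_eq' _ _ _, if_pos (hf I hI)]
  · unfold purePlan
    split_ifs <;> norm_num
  · simp [purePlan, hw]

/-- Towards any sequence there is a plan that incurs only the loss along the sequence. -/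
lemma exists_plan_cost_eq (hG : G.PerfectRecall) (hℓ : G.IsLoss i ℓ) {w : MoveSet A}
    (hw : w ∈ G.seqs (some i)) : ∃ x ∈ G.plans i, x w = 1 ∧ G.cost i ℓ x = lossOf ℓ w := by
  classical
  -- The strategy follows `w` at the information sets where `w` prescribes a move, and is lossless
  -- elsewhere.
  have hex : ∀ I : Finset (List A), I ∈ G.infoSets (some i) → ∃ a ∈ G.infoActions I,
      ((I, a) ∈ w ∨ ((∀ b, (I, b) ∉ w) ∧ ℓ (I, a) = 0)) := by
    intro I hI
    by_cases h : ∃ b, (I, b) ∈ w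
    · obtain ⟨b, hb⟩ := h
      exact ⟨b, (mem_of_mem_seqs hG hw hb).2.1, Or.inl hb⟩
    · push Not at h
      obtain ⟨a, ha, h0⟩ := (hℓ I hI).2
      exact ⟨a, ha, Or.inr ⟨h, h0⟩⟩
  -- Without information sets the type `A` may be empty, and then no pure strategy exists as a
  -- function.
  by_cases hne : G.infoSets (some i) = ∅
  · have hm : G.moves i = ∅ := by simp [moves, hne]
    have hw0 : w = ∅ := Finset.subset_empty.1 (hm ▸ subset_moves hG hw)
    refine ⟨fun v => if v = ∅ then 1 else 0, ⟨by simp, by simp [hne], by simp [hne], ?_⟩,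
      by simp [hw0], by simp [cost, hm, hw0, lossOf]⟩
    intro v hv
    refine if_neg ?_
    rintro rfl
    exact hv empty_mem_seqs
  · obtain ⟨I₀, hI₀⟩ := Finset.nonempty_iff_ne_empty.2 hne
    obtain ⟨a₀, -, -⟩ := hex I₀ hI₀
    have : ∀ I : Finset (List A), ∃ a, I ∈ G.infoSets (some i) → a ∈ G.infoActions I ∧
        ((I, a) ∈ w ∨ ((∀ b, (I, b) ∉ w) ∧ ℓ (I, a) = 0)) := by
      intro I
      by_cases hI : I ∈ G.infoSets (some i)
      · obtain ⟨a, ha⟩ := hex I hI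
        exact ⟨a, fun _ => ha⟩
      · exact ⟨a₀, fun h => absurd h hI⟩
    choose f hf using this
    have hfw : ∀ m ∈ w, m.2 = f m.1 := by
      intro m hm
      rcases (hf m.1 (mem_of_mem_seqs hG hw hm).1).2 with h | h
      · exact action_unique hG hw hm h
      · exact absurd hm (h.1 m.2)
    refine ⟨G.purePlan i f, purePlan_mem_plans hG fun I hI => (hf I hI).1,
      if_pos ⟨hw, hfw⟩, ?_⟩
    rw [cost, ← Finset.sum_subset (subset_moves hG hw), lossOf]
    · refine Finset.sum_congr rfl fun m hm => ?_
      obtain ⟨h1, h2, h3⟩ := mem_of_mem_seqs hG hw hm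
      rw [purePlan, if_pos ⟨seqExt_mem_seqs hG h1 h2, fun m' hm' => hfw m' (h3 hm')⟩, one_mul]
    · intro m hm hmw
      obtain ⟨hI, ha⟩ := mem_moves.1 hm
      rw [purePlan_seqExt hG f hI ha]
      split_ifs with h
      · rcases (hf m.1 hI).2 with h' | h'
        · rw [← h] at h'
          exact absurd h' hmw
        · rw [← h] at h'
          rw [h'.2, mul_zero]
      · rw [zero_mul]

end Losses

section Payoffs

variable [Fintype N]

/-- The payoffs against a fixed profile in terms of losses. -/
lemma exists_loss_payoff (hG : G.PerfectRecall) (i : N) (γ : PlanProfile N A) :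
    ∃ ℓ, G.IsLoss i ℓ ∧ ∃ K K' : ℝ,
      (∀ x ∈ G.plans i, G.objective i x γ = K - G.cost i ℓ x) ∧
      ∀ w ∈ G.seqs (some i), G.maxPayoff i w γ = K' - lossOf ℓ w := by
  obtain ⟨ℓ, hℓ, K, hK⟩ := exists_loss (i := i) hG fun w => G.payoffAt i w γ
  have hexp : ∀ x ∈ G.plans i,
      G.expectedPayoff i x γ = G.payoffAt i ∅ γ + K - G.cost i ℓ x := by
    intro x hx
    rw [expectedPayoff, sum_seqs hG, hx.1, hK x hx]
    ring
  refine ⟨ℓ, hℓ, K, G.payoffAt i ∅ γ + K, hK, fun w hw => ?_⟩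
  refine IsGreatest.csSup_eq ⟨?_, ?_⟩
  · obtain ⟨x, hx, hxw, hc⟩ := exists_plan_cost_eq hG hℓ hw
    exact ⟨x, ⟨hx, hxw⟩, by rw [← hc]; exact hexp x hx⟩
  · rintro _ ⟨x, ⟨hx, hxw⟩, rfl⟩
    have := lossOf_le_cost hG hℓ hx hw hxw
    simp only [hexp x hx]
    linarith

end Payoffs

end ExtensiveGame

namespace ExtensiveGame

variable {N A : Type*} [DecidableEq N] [DecidableEq A] {G : ExtensiveGame N A} {i : N}

/-! ### The weight of an admissible set as a sum over information sets. -/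

section Weights

variable (G) in
/-- The contribution of an information set to the weight of an antichain of sequences. -/
def share (i : N) (E : Finset (MoveSet A)) (I : Finset (List A)) : ℕ :=
  if ∃ w ∈ E, w ⊆ G.seqTo (some i) I then (G.infoActions I).card - 1
  else ((G.infoActions I).filter fun a => G.seqExt (some i) I a ∈ E).card

lemma card_eq_sum_card_filter (hG : G.PerfectRecall) {E : Finset (MoveSet A)}
    (hE : E ⊆ G.seqs (some i)) (h0 : ∅ ∉ E) :
    E.card = ∑ I ∈ G.infoSets (some i),
      ((G.infoActions I).filter fun a => G.seqExt (some i) I a ∈ E).card := by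
  have h := sum_seqs (i := i) hG fun w => if w ∈ E then (1 : ℝ) else 0
  rw [if_neg h0, zero_add, ← Finset.sum_filter, Finset.filter_mem_eq_inter,
    Finset.inter_eq_right.2 hE] at h
  simp only [← Finset.sum_filter, Finset.sum_const, nsmul_eq_mul, mul_one] at h
  exact_mod_cast h

/-- Exchange the sums in `q(E)`. The sequences contained in the one leading to `I` form a chain, so
an antichain has at most one of them; if it has one, it contains no extension at `I`. The ones in
`κ` count the members of `E` at the information set of their last move. -/
lemma weight_eq_sum_share (hG : G.PerfectRecall) {E : Finset (MoveSet A)}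
    (hE : E ⊆ G.seqs (some i)) (h0 : ∅ ∉ E) (hanti : ∀ v ∈ E, ∀ w ∈ E, ¬ w ⊂ v) :
    G.weight i E = ∑ I ∈ G.infoSets (some i), G.share i E I := by
  have h1 : G.weight i E = ∑ I ∈ G.infoSets (some i),
      (E.filter fun w => w ⊆ G.seqTo (some i) I).card * ((G.infoActions I).card - 1) +
        E.card := by
    simp only [weight, kappa, Finset.sum_add_distrib, Finset.card_eq_sum_ones, Finset.sum_mul,
      one_mul]
    congr 1
    refine Finset.sum_comm' fun w I => ?_
    simp only [Finset.mem_filter]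
    tauto
  rw [h1, card_eq_sum_card_filter hG hE h0, ← Finset.sum_add_distrib]
  refine Finset.sum_congr rfl fun I hI => ?_
  unfold share
  split_ifs with h
  · obtain ⟨w, hw, hwI⟩ := h
    have h2 : E.filter (fun w => w ⊆ G.seqTo (some i) I) = {w} := by
      refine Finset.eq_singleton_iff_unique_mem.2 ⟨Finset.mem_filter.2 ⟨hw, hwI⟩, fun v hv => ?_⟩
      obtain ⟨hv, hvI⟩ := Finset.mem_filter.1 hv
      by_contra hne
      rcases subset_total hG (hE hv) (hE hw) (seqTo_mem_seqs hG hI) hvI hwI with h | h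
      · exact hanti w hw v hv (h.ssubset_of_ne hne)
      · exact hanti v hv w hw (h.ssubset_of_ne (Ne.symm hne))
    have h3 : (G.infoActions I).filter (fun a => G.seqExt (some i) I a ∈ E) = ∅ := by
      refine Finset.filter_eq_empty_iff.2 fun a _ ha => ?_
      exact hanti _ ha w hw (hwI.trans_ssubset (seqTo_ssubset_seqExt hG hI a))
    rw [h2, h3]
    simp
  · have h2 : E.filter (fun w => w ⊆ G.seqTo (some i) I) = ∅ :=
      Finset.filter_eq_empty_iff.2 fun w hw hwI => h ⟨w, hw, hwI⟩
    rw [h2]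
    simp

lemma IsAdmissible.weight_eq (hG : G.PerfectRecall) {E : Finset (MoveSet A)}
    (hE : G.IsAdmissible i E) : G.weight i E = ∑ I ∈ G.infoSets (some i), G.share i E I :=
  weight_eq_sum_share hG hE.1 hE.2.2.1 hE.2.2.2.2

/-- Some extension at `I` is always missing from `E`. Hence comparisons of weight can be made one
information set at a time. -/
lemma IsAdmissible.share_le {E : Finset (MoveSet A)} (hE : G.IsAdmissible i E)
    {I : Finset (List A)} (hI : I ∈ G.infoSets (some i)) :
    G.share i E I ≤ (G.infoActions I).card - 1 := by
  unfold share
  split_ifs with h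
  · exact le_rfl
  · refine Nat.le_sub_one_of_lt (Finset.card_lt_card ?_)
    refine (Finset.filter_subset _ _).ssubset_of_ne fun h' => hE.2.2.2.1 I hI ?_
    intro w hw
    obtain ⟨a, ha, rfl⟩ := Finset.mem_image.1 hw
    exact Finset.filter_eq_self.1 h' a ha

lemma kappa_empty : G.kappa i ∅ =
    ∑ I ∈ G.infoSets (some i), ((G.infoActions I).card - 1) + 1 := by
  simp [kappa]

lemma IsAdmissible.weight_lt_kappa (hG : G.PerfectRecall) {E : Finset (MoveSet A)}
    (hE : G.IsAdmissible i E) : G.weight i E < G.kappa i ∅ := by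
  rw [hE.weight_eq hG, kappa_empty, Nat.lt_succ_iff]
  exact Finset.sum_le_sum fun I hI => hE.share_le hI

lemma kappa_pos (w : MoveSet A) : 0 < G.kappa i w := Nat.succ_pos _

lemma weight_pos {E : Finset (MoveSet A)} (hE : E.Nonempty) : 0 < G.weight i E :=
  Finset.sum_pos (fun w _ => kappa_pos w) hE

end Weights

/-! ### Cuts at a loss level, and their extremal role among admissible sets. -/

section Cuts

variable {ℓ : Finset (List A) × A → ℝ}

variable (G) in
/-- The minimal sequences among those with loss at least `t`. -/
def cut (i : N) (ℓ : Finset (List A) × A → ℝ) (t : ℝ) : Finset (MoveSet A) :=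
  (G.seqs (some i)).filter fun w =>
    t ≤ lossOf ℓ w ∧ ∀ v ∈ G.seqs (some i), v ⊂ w → lossOf ℓ v < t

lemma cut_subset (t : ℝ) : G.cut i ℓ t ⊆ G.seqs (some i) := Finset.filter_subset _ _

lemma le_lossOf_of_mem_cut {t : ℝ} {w : MoveSet A} (hw : w ∈ G.cut i ℓ t) : t ≤ lossOf ℓ w :=
  (Finset.mem_filter.1 hw).2.1

lemma cut_antichain {t : ℝ} {v w : MoveSet A} (hv : v ∈ G.cut i ℓ t) (hw : w ∈ G.cut i ℓ t) :
    ¬ w ⊂ v := fun h =>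
  not_lt.2 (le_lossOf_of_mem_cut hw) ((Finset.mem_filter.1 hv).2.2 w (cut_subset t hw) h)

lemma exists_mem_cut_subset {t : ℝ} {w : MoveSet A} (hw : w ∈ G.seqs (some i))
    (ht : t ≤ lossOf ℓ w) : ∃ u ∈ G.cut i ℓ t, u ⊆ w := by
  have hne : ((G.seqs (some i)).filter fun u => u ⊆ w ∧ t ≤ lossOf ℓ u).Nonempty :=
    ⟨w, Finset.mem_filter.2 ⟨hw, Finset.Subset.refl w, ht⟩⟩
  obtain ⟨u, hu, hmin⟩ := Finset.exists_min_image _ Finset.card hne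
  obtain ⟨hu, huw, htu⟩ := Finset.mem_filter.1 hu
  refine ⟨u, Finset.mem_filter.2 ⟨hu, htu, fun v hv hvu => ?_⟩, huw⟩
  by_contra hlt
  exact not_le.2 (Finset.card_lt_card hvu)
    (hmin v (Finset.mem_filter.2 ⟨hv, hvu.1.trans huw, not_lt.1 hlt⟩))

lemma empty_mem_cut {t : ℝ} : ∅ ∈ G.cut i ℓ t ↔ t ≤ 0 := by
  simp [cut, empty_mem_seqs, lossOf_empty, Finset.not_ssubset_empty]

/-- Losses increase along sequences, so minimality need only be tested on the immediate predecessor.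
-/
lemma seqExt_mem_cut (hG : G.PerfectRecall) (hℓ : G.IsLoss i ℓ) {t : ℝ} {I : Finset (List A)}
    (hI : I ∈ G.infoSets (some i)) {a : A} (ha : a ∈ G.infoActions I) :
    G.seqExt (some i) I a ∈ G.cut i ℓ t ↔
      lossOf ℓ (G.seqTo (some i) I) < t ∧ t ≤ lossOf ℓ (G.seqExt (some i) I a) := by
  simp only [cut, Finset.mem_filter, seqExt_mem_seqs hG hI ha, true_and]
  rw [and_comm]
  refine and_congr_left fun _ => ⟨fun h => ?_, fun h v hv hlt => ?_⟩
  · exact h _ (seqTo_mem_seqs hG hI) (seqTo_ssubset_seqExt hG hI a)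
  · exact (lossOf_mono hG hℓ (seqTo_mem_seqs hG hI) (subset_seqTo_of_ssubset hG hv hlt)).trans_lt h

lemma cut_zero : G.cut i ℓ 0 = {∅} := by
  have h0 : ∅ ∈ G.cut i ℓ 0 := empty_mem_cut.2 le_rfl
  refine Finset.eq_singleton_iff_unique_mem.2 ⟨h0, fun w hw => ?_⟩
  by_contra hne
  exact cut_antichain hw h0 (Finset.empty_ssubset.2 (Finset.nonempty_iff_ne_empty.2 hne))

lemma weight_cut_zero :
    G.weight i (G.cut i ℓ 0) = G.kappa i ∅ := by
  rw [cut_zero, weight, Finset.sum_singleton]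

/-- A lossless action does not change the loss, so its extension never crosses a level. -/
lemma not_image_seqExt_subset_cut (hG : G.PerfectRecall) (hℓ : G.IsLoss i ℓ) {t : ℝ}
    {I : Finset (List A)} (hI : I ∈ G.infoSets (some i)) :
    ¬ (G.infoActions I).image (G.seqExt (some i) I) ⊆ G.cut i ℓ t := by
  intro h
  obtain ⟨a, ha, h0⟩ := (hℓ I hI).2
  have h1 := (seqExt_mem_cut hG hℓ hI ha).1 (h (Finset.mem_image_of_mem _ ha))
  rw [lossOf_seqExt hG hI, h0, add_zero] at h1
  exact absurd h1.2 (not_le.2 h1.1)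

lemma cut_admissible (hG : G.PerfectRecall) (hℓ : G.IsLoss i ℓ) {t : ℝ} (ht : 0 < t)
    {w : MoveSet A} (hw : w ∈ G.seqs (some i)) (htw : t ≤ lossOf ℓ w) :
    G.IsAdmissible i (G.cut i ℓ t) := by
  obtain ⟨u, hu, -⟩ := exists_mem_cut_subset hw htw
  exact ⟨cut_subset t, ⟨u, hu⟩, fun h => not_le.2 ht (empty_mem_cut.1 h),
    fun I hI => not_image_seqExt_subset_cut hG hℓ hI, fun v hv w hw => cut_antichain hv hw⟩

/-- Among the admissible sets of sequences with loss at least `t`, the cut is of maximal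
weight. -/
lemma weight_lt_or_cut_subset (hG : G.PerfectRecall) (hℓ : G.IsLoss i ℓ) {t : ℝ} (ht : 0 ≤ t)
    {E : Finset (MoveSet A)} (hE : G.IsAdmissible i E) (hEt : ∀ w ∈ E, t ≤ lossOf ℓ w) :
    G.weight i E < G.weight i (G.cut i ℓ t) ∨
      (0 < t ∧ G.weight i E = G.weight i (G.cut i ℓ t) ∧ G.cut i ℓ t ⊆ E) := by
  rcases ht.eq_or_lt with rfl | ht
  -- The cut at `0` is `{∅}`, which is not admissible; its weight `κ(∅)` exceeds all admissible
  -- ones.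
  · rw [weight_cut_zero]
    exact Or.inl (hE.weight_lt_kappa hG)
  obtain ⟨w₀, hw₀⟩ := hE.2.1
  have hC := cut_admissible hG hℓ ht (hE.1 hw₀) (hEt w₀ hw₀)
  have hle : ∀ I ∈ G.infoSets (some i), G.share i E I ≤ G.share i (G.cut i ℓ t) I := by
    intro I hI
    by_cases h : ∃ w ∈ G.cut i ℓ t, w ⊆ G.seqTo (some i) I
    · have : G.share i (G.cut i ℓ t) I = (G.infoActions I).card - 1 := if_pos h
      rw [this]
      exact hE.share_le hI
    -- Every member of `E` lies above a member of the cut. Where the cut has not yet been passed,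
    -- neither has `E`, and extensions in `E` are themselves in the cut.
    · have hEI : ¬ ∃ w ∈ E, w ⊆ G.seqTo (some i) I := by
        rintro ⟨w, hw, hwI⟩
        obtain ⟨u, hu, huw⟩ := exists_mem_cut_subset (hE.1 hw) (hEt w hw)
        exact h ⟨u, hu, huw.trans hwI⟩
      rw [share, if_neg hEI, share, if_neg h]
      refine Finset.card_le_card fun a ha => ?_
      obtain ⟨ha, haE⟩ := Finset.mem_filter.1 ha
      refine Finset.mem_filter.2 ⟨ha, (seqExt_mem_cut hG hℓ hI ha).2 ⟨?_, hEt _ haE⟩⟩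
      by_contra hlt
      obtain ⟨u, hu, huw⟩ := exists_mem_cut_subset (seqTo_mem_seqs hG hI) (not_lt.1 hlt)
      exact h ⟨u, hu, huw⟩
  rcases (Finset.sum_le_sum hle).lt_or_eq with hlt | heq
  · left
    rw [hE.weight_eq hG, hC.weight_eq hG]
    exact hlt
  -- Equal weights force equal shares everywhere; at the last information set of a cut member the
  -- two sets of extensions then coincide.
  · refine Or.inr ⟨ht, by rw [hE.weight_eq hG, hC.weight_eq hG, heq], fun w hw => ?_⟩
    have hne : w ≠ ∅ := fun h => hC.2.2.1 (h ▸ hw)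
    obtain ⟨I, hI, a, ha, rfl⟩ := exists_seqExt hG (cut_subset t hw) hne
    have hs := (Finset.sum_eq_sum_iff_of_le hle).1 heq I hI
    have hlt := ((seqExt_mem_cut hG hℓ hI ha).1 hw).1
    have h1 : ∀ F : Finset (MoveSet A), F ⊆ G.seqs (some i) → (∀ w ∈ F, t ≤ lossOf ℓ w) →
        ¬ ∃ w ∈ F, w ⊆ G.seqTo (some i) I := by
      rintro F - hF ⟨v, hv, hvI⟩
      exact not_lt.2 ((hF v hv).trans (lossOf_mono hG hℓ (seqTo_mem_seqs hG hI) hvI)) hlt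
    rw [share, if_neg (h1 E hE.1 hEt), share,
      if_neg (h1 _ (cut_subset t) fun w hw => le_lossOf_of_mem_cut hw)] at hs
    have hsub : (G.infoActions I).filter (fun a => G.seqExt (some i) I a ∈ E) ⊆
        (G.infoActions I).filter fun a => G.seqExt (some i) I a ∈ G.cut i ℓ t := by
      intro b hb
      obtain ⟨hb, hbE⟩ := Finset.mem_filter.1 hb
      exact Finset.mem_filter.2 ⟨hb, (seqExt_mem_cut hG hℓ hI hb).2 ⟨hlt, hEt _ hbE⟩⟩
    have hmem : a ∈ (G.infoActions I).filter fun a => G.seqExt (some i) I a ∈ G.cut i ℓ t :=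
      Finset.mem_filter.2 ⟨ha, hw⟩
    rw [← Finset.eq_of_subset_of_card_le hsub hs.ge] at hmem
    exact (Finset.mem_filter.1 hmem).2

/-- The higher cut competes with the lower one in `weight_lt_or_cut_subset`; it cannot contain it,
as some member of the lower cut has loss at most that of `v`. -/
lemma weight_cut_strictAnti (hG : G.PerfectRecall) (hℓ : G.IsLoss i ℓ) {v w : MoveSet A}
    (hv : v ∈ G.seqs (some i)) (hw : w ∈ G.seqs (some i)) (hvw : lossOf ℓ v < lossOf ℓ w) :
    G.weight i (G.cut i ℓ (lossOf ℓ w)) < G.weight i (G.cut i ℓ (lossOf ℓ v)) := by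
  have hv0 := lossOf_nonneg hG hℓ hv
  have hC := cut_admissible hG hℓ (hv0.trans_lt hvw) hw le_rfl
  rcases weight_lt_or_cut_subset hG hℓ hv0 hC
    (fun u hu => hvw.le.trans (le_lossOf_of_mem_cut hu)) with h | ⟨-, -, h⟩
  · exact h
  · obtain ⟨u, hu, huv⟩ := exists_mem_cut_subset hv (le_refl (lossOf ℓ v))
    exact absurd ((le_lossOf_of_mem_cut (h hu)).trans (lossOf_mono hG hℓ hv huv))
      (not_le.2 hvw)

lemma weight_cut_le_kappa (hG : G.PerfectRecall) (hℓ : G.IsLoss i ℓ) {w : MoveSet A}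
    (hw : w ∈ G.seqs (some i)) : G.weight i (G.cut i ℓ (lossOf ℓ w)) ≤ G.kappa i ∅ := by
  rcases (lossOf_nonneg hG hℓ hw).eq_or_lt with h | h
  · rw [← h, weight_cut_zero]
  · exact ((cut_admissible hG hℓ h hw le_rfl).weight_lt_kappa hG).le

lemma weight_cut_pos {w : MoveSet A} (hw : w ∈ G.seqs (some i)) :
    0 < G.weight i (G.cut i ℓ (lossOf ℓ w)) := by
  obtain ⟨u, hu, -⟩ := exists_mem_cut_subset hw (le_refl (lossOf ℓ w))
  exact weight_pos ⟨u, hu⟩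

lemma le_sum_cut (hG : G.PerfectRecall) {x : MoveSet A → ℝ} (hx : x ∈ G.plans i)
    {t : ℝ} {w : MoveSet A} (hw : w ∈ G.seqs (some i)) (htw : t ≤ lossOf ℓ w) :
    x w ≤ ∑ u ∈ G.cut i ℓ t, x u := by
  obtain ⟨u, hu, huw⟩ := exists_mem_cut_subset hw htw
  exact (plan_anti hG hx (cut_subset t hu) hw huw).trans
    (Finset.single_le_sum (f := x) (fun v _ => plan_nonneg hG hx v) hu)

/-- The expected loss as a combination of the probabilities of the cuts. -/
lemma cost_eq_sum_cut (hG : G.PerfectRecall) (hℓ : G.IsLoss i ℓ) {T : Finset ℝ} {c : ℝ → ℝ}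
    (hc : ∀ w ∈ G.seqs (some i), ∑ t ∈ T with t ≤ lossOf ℓ w, c t = lossOf ℓ w)
    (x : MoveSet A → ℝ) :
    G.cost i ℓ x = ∑ t ∈ T, c t * ∑ w ∈ G.cut i ℓ t, x w := by
  have h0 : ∑ t ∈ T with t ≤ 0, c t = 0 := by
    have := hc ∅ empty_mem_seqs
    rwa [lossOf_empty] at this
  have h1 : ∀ t, ∑ w ∈ G.cut i ℓ t, x w = (if t ≤ 0 then x ∅ else 0) +
      ∑ m ∈ G.moves i,
        if G.seqExt (some i) m.1 m.2 ∈ G.cut i ℓ t then x (G.seqExt (some i) m.1 m.2) else 0 := by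
    intro t
    rw [sum_moves]
    have := sum_seqs (i := i) hG fun w => if w ∈ G.cut i ℓ t then x w else 0
    rw [← Finset.sum_filter, Finset.filter_mem_eq_inter,
      Finset.inter_eq_right.2 (cut_subset t)] at this
    rw [this]
    simp only [empty_mem_cut]
  simp only [h1, mul_add, Finset.sum_add_distrib]
  -- The empty sequence lies in the cuts at levels `t ≤ 0`, whose coefficients sum to its loss,
  -- zero.
  have h2 : ∑ t ∈ T, c t * (if t ≤ 0 then x ∅ else 0) = 0 := by
    simp only [mul_ite, mul_zero]
    rw [← Finset.sum_filter, ← Finset.sum_mul, h0, zero_mul]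
  rw [h2, zero_add, cost]
  simp only [Finset.mul_sum]
  rw [Finset.sum_comm]
  refine Finset.sum_congr rfl fun m hm => ?_
  obtain ⟨hI, ha⟩ := mem_moves.1 hm
  -- The loss of a move is the sum of the increments over the levels that the move crosses.
  have h3 : ℓ m = ∑ t ∈ T, if G.seqExt (some i) m.1 m.2 ∈ G.cut i ℓ t then c t else 0 := by
    have h4 := hc _ (seqExt_mem_seqs hG hI ha)
    have h5 := hc _ (seqTo_mem_seqs hG hI)
    have h6 := lossOf_seqExt (ℓ := ℓ) hG hI m.2
    have h7 := lossOf_mono hG hℓ (seqExt_mem_seqs hG hI ha) (seqTo_ssubset_seqExt hG hI m.2).1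
    have h8 : ℓ m = ∑ t ∈ T with t ≤ lossOf ℓ (G.seqExt (some i) m.1 m.2), c t -
        ∑ t ∈ T with t ≤ lossOf ℓ (G.seqTo (some i) m.1), c t := by
      rw [h4, h5, h6]
      simp
    rw [h8, Finset.sum_filter, Finset.sum_filter, ← Finset.sum_sub_distrib]
    refine Finset.sum_congr rfl fun t _ => ?_
    simp only [seqExt_mem_cut hG hℓ hI ha]
    by_cases h9 : t ≤ lossOf ℓ (G.seqTo (some i) m.1)
    · simp [h9, h9.trans h7, not_lt.2 h9]
    · simp [h9, not_le.1 h9]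
  rw [h3, Finset.mul_sum]
  refine Finset.sum_congr rfl fun t _ => ?_
  split_ifs <;> ring

/-- A plan satisfies the constraints for all admissible sets if it does so for the cuts, and
single sequences satisfy slightly weaker ones. -/
lemma le_sum_of_le_sum_cut (hG : G.PerfectRecall) (hℓ : G.IsLoss i ℓ) {x : MoveSet A → ℝ}
    (hx : x ∈ G.plans i) {S : ℕ → ℝ} (hS : Monotone S)
    (h1 : ∀ w ∈ G.seqs (some i), S (G.weight i (G.cut i ℓ (lossOf ℓ w)) - 1) ≤ x w)
    (h2 : ∀ w ∈ G.seqs (some i), 0 < lossOf ℓ w →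
      S (G.weight i (G.cut i ℓ (lossOf ℓ w))) ≤ ∑ u ∈ G.cut i ℓ (lossOf ℓ w), x u)
    {E : Finset (MoveSet A)} (hE : G.IsAdmissible i E) : S (G.weight i E) ≤ ∑ w ∈ E, x w := by
  obtain ⟨w, hw, hmin⟩ := Finset.exists_min_image E (lossOf ℓ) hE.2.1
  rcases weight_lt_or_cut_subset hG hℓ (lossOf_nonneg hG hℓ (hE.1 hw)) hE hmin with
    h | ⟨hpos, h, hsub⟩
  · calc S (G.weight i E) ≤ S (G.weight i (G.cut i ℓ (lossOf ℓ w)) - 1) :=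
          hS (Nat.le_sub_one_of_lt h)
      _ ≤ x w := h1 w (hE.1 hw)
      _ ≤ _ := Finset.single_le_sum (f := x) (fun v _ => plan_nonneg hG hx v) hw
  · rw [h]
    exact (h2 w (hE.1 hw) hpos).trans
      (Finset.sum_le_sum_of_subset_of_nonneg hsub fun v _ _ => plan_nonneg hG hx v)

/-- A sequence of loss less than `t` can be added to the cut at `t`, at the expense of its
extensions, and this increases the weight. -/
lemma insert_cut_admissible (hG : G.PerfectRecall) (hℓ : G.IsLoss i ℓ) {t : ℝ} (ht : 0 < t)
    {v : MoveSet A} (hv : v ∈ G.seqs (some i)) (htv : t ≤ lossOf ℓ v) {I : Finset (List A)}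
    (hI : I ∈ G.infoSets (some i)) {a b : A} (ha : a ∈ G.infoActions I)
    (hb : b ∈ G.infoActions I) (hab : b ≠ a) (hbt : G.seqExt (some i) I b ∉ G.cut i ℓ t)
    (hlt : lossOf ℓ (G.seqExt (some i) I a) < t) :
    G.IsAdmissible i (insert (G.seqExt (some i) I a)
      ((G.cut i ℓ t).filter fun u => ¬ G.seqExt (some i) I a ⊆ u)) ∧
    G.weight i (G.cut i ℓ t) < G.weight i (insert (G.seqExt (some i) I a)
      ((G.cut i ℓ t).filter fun u => ¬ G.seqExt (some i) I a ⊆ u)) := by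
  set w := G.seqExt (some i) I a with hw
  set E := insert w ((G.cut i ℓ t).filter fun u => ¬ w ⊆ u) with hEdef
  have hC := cut_admissible hG hℓ ht hv htv
  have hws : w ∈ G.seqs (some i) := seqExt_mem_seqs hG hI ha
  have hmem : ∀ u, u ∈ E ↔ u = w ∨ (u ∈ G.cut i ℓ t ∧ ¬ w ⊆ u) := fun u => by
    rw [hEdef, Finset.mem_insert, Finset.mem_filter]
  have hsub : ∀ u ∈ G.cut i ℓ t, ¬ u ⊆ w := fun u hu huw =>
    not_lt.2 ((le_lossOf_of_mem_cut hu).trans (lossOf_mono hG hℓ hws huw)) hlt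
  have hadm : G.IsAdmissible i E := by
    refine ⟨fun u hu => ?_, ⟨w, (hmem w).2 (Or.inl rfl)⟩, fun h0 => ?_, fun J hJ h => ?_,
      fun u hu u' hu' h => ?_⟩
    · rcases (hmem u).1 hu with rfl | h
      · exact hws
      · exact cut_subset t h.1
    · rcases (hmem ∅).1 h0 with h | h
      · exact seqExt_ne_empty I a h.symm
      · exact hC.2.2.1 h.1
    · by_cases hJI : J = I
      · subst hJI
        rcases (hmem _).1 (h (Finset.mem_image_of_mem _ hb)) with h' | h'
        · exact hab (seqExt_inj hG hI h').2
        · exact hbt h'.1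
      · refine hC.2.2.2.1 J hJ fun u hu => ?_
        rcases (hmem u).1 (h hu) with rfl | h'
        · obtain ⟨c, hc, hcw⟩ := Finset.mem_image.1 hu
          exact absurd (seqExt_inj hG hI hcw).1 hJI
        · exact h'.1
    · rcases (hmem u).1 hu with rfl | hu <;> rcases (hmem u').1 hu' with rfl | hu'
      · exact h.2 h.1
      · exact hsub u' hu'.1 h.1
      · exact hu.2 h.1
      · exact cut_antichain hu.1 hu'.1 h
  refine ⟨hadm, ?_⟩
  rw [hC.weight_eq hG, hadm.weight_eq hG]
  have hbelow : ∀ J, (∃ u ∈ G.cut i ℓ t, u ⊆ G.seqTo (some i) J) →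
      ∃ u ∈ E, u ⊆ G.seqTo (some i) J := by
    rintro J ⟨u, hu, huJ⟩
    by_cases hwu : w ⊆ u
    · exact ⟨w, (hmem w).2 (Or.inl rfl), hwu.trans huJ⟩
    · exact ⟨u, (hmem u).2 (Or.inr ⟨hu, hwu⟩), huJ⟩
  have hfilter : ∀ J ∈ G.infoSets (some i), (¬ ∃ u ∈ E, u ⊆ G.seqTo (some i) J) →
      (G.infoActions J).filter (fun c => G.seqExt (some i) J c ∈ G.cut i ℓ t) ⊆
        (G.infoActions J).filter fun c => G.seqExt (some i) J c ∈ E := by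
    intro J hJ h c hc
    obtain ⟨hc, hct⟩ := Finset.mem_filter.1 hc
    refine Finset.mem_filter.2 ⟨hc, (hmem _).2 (Or.inr ⟨hct, fun hwu => ?_⟩)⟩
    rcases hwu.eq_or_ssubset with heq | hss
    · exact hsub _ hct heq.superset
    · exact h ⟨w, (hmem w).2 (Or.inl rfl), subset_seqTo_of_ssubset hG hws hss⟩
  refine Finset.sum_lt_sum (fun J hJ => ?_) ⟨I, hI, ?_⟩
  · by_cases h : ∃ u ∈ E, u ⊆ G.seqTo (some i) J
    · have : G.share i E J = (G.infoActions J).card - 1 := if_pos h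
      rw [this]
      exact hC.share_le hJ
    · rw [share, if_neg fun h' => h (hbelow J h'), share, if_neg h]
      exact Finset.card_le_card (hfilter J hJ h)
  · have h : ¬ ∃ u ∈ E, u ⊆ G.seqTo (some i) I := by
      rintro ⟨u, hu, huI⟩
      rcases (hmem u).1 hu with rfl | hu
      · exact (seqTo_ssubset_seqExt hG hI a).2 huI
      · exact hsub u hu.1 (huI.trans (seqTo_ssubset_seqExt hG hI a).1)
    rw [share, if_neg fun h' => h (hbelow I h'), share, if_neg h]
    -- No share decreases, and at `I` the action `a` is gained.
    refine Finset.card_lt_card ((hfilter I hI h).ssubset_of_ne fun heq => ?_)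
    have hin : a ∈ (G.infoActions I).filter fun c => G.seqExt (some i) I c ∈ E :=
      Finset.mem_filter.2 ⟨ha, (hmem _).2 (Or.inl rfl)⟩
    rw [← heq] at hin
    exact hsub _ (Finset.mem_filter.1 hin).2 (Finset.Subset.refl _)

/-- A lower bound on the probability of the sequences with small loss, for plans that satisfy
the constraints of the admissible sets. -/
lemma le_add_sum_cut (hG : G.PerfectRecall) (hℓ : G.IsLoss i ℓ) {x : MoveSet A → ℝ}
    (hx : x ∈ G.plans i) {t : ℝ} (ht : 0 < t) {v : MoveSet A} (hv : v ∈ G.seqs (some i))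
    (htv : t ≤ lossOf ℓ v) {ρ : ℝ} (hρ : ρ ≤ 1)
    (hadm : ∀ E, G.IsAdmissible i E → G.weight i (G.cut i ℓ t) < G.weight i E →
      ρ ≤ ∑ u ∈ E, x u)
    {w : MoveSet A} (hw : w ∈ G.seqs (some i)) (hlt : lossOf ℓ w < t) :
    ρ ≤ x w + ∑ u ∈ G.cut i ℓ t with ¬ w ⊆ u, x u := by
  revert hlt
  refine seqs_induction hG
    (P := fun w => lossOf ℓ w < t → ρ ≤ x w + ∑ u ∈ G.cut i ℓ t with ¬ w ⊆ u, x u) ?_ ?_ hw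
  · intro _
    rw [hx.1]
    exact hρ.trans (le_add_of_nonneg_right (Finset.sum_nonneg fun u _ => plan_nonneg hG hx u))
  · intro I hI a ha ih hlt
    -- Either the enlarged cut is admissible, or all sibling extensions are in the cut. In the
    -- latter case the mass of the predecessor splits into `x w` and siblings already counted in the
    -- cut sum.
    by_cases hex : ∃ b ∈ G.infoActions I, b ≠ a ∧ G.seqExt (some i) I b ∉ G.cut i ℓ t
    · obtain ⟨b, hb, hab, hbt⟩ := hex
      obtain ⟨h1, h2⟩ := insert_cut_admissible hG hℓ ht hv htv hI ha hb hab hbt hlt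
      have h3 := hadm _ h1 h2
      rwa [Finset.sum_insert] at h3
      simp
    · push Not at hex
      have h1 := ih ((lossOf_mono hG hℓ (seqExt_mem_seqs hG hI ha)
        (seqTo_ssubset_seqExt hG hI a).1).trans_lt hlt)
      rw [← hx.2.1 I hI, ← Finset.add_sum_erase _ _ ha, add_assoc] at h1
      refine h1.trans (add_le_add_right ?_ _)
      rw [← Finset.sum_image (f := x) (g := G.seqExt (some i) I)
        (fun b _ c _ h => (seqExt_inj hG hI h).2), ← Finset.sum_union]
      · refine Finset.sum_le_sum_of_subset_of_nonneg (fun u hu => ?_)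
          fun u _ _ => plan_nonneg hG hx u
        rcases Finset.mem_union.1 hu with hu | hu
        · obtain ⟨b, hb, rfl⟩ := Finset.mem_image.1 hu
          obtain ⟨hba, hb⟩ := Finset.mem_erase.1 hb
          refine Finset.mem_filter.2 ⟨hex b hb hba, fun hsub => hba ?_⟩
          exact (action_unique hG (seqExt_mem_seqs hG hI hb) (hsub (mem_seqExt_self I a))
            (mem_seqExt_self I b)).symm
        · obtain ⟨hu, hIu⟩ := Finset.mem_filter.1 hu
          exact Finset.mem_filter.2
            ⟨hu, fun h => hIu ((seqTo_ssubset_seqExt hG hI a).1.trans h)⟩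
      · refine Finset.disjoint_left.2 fun u hu hu' => ?_
        obtain ⟨b, hb, rfl⟩ := Finset.mem_image.1 hu
        exact (Finset.mem_filter.1 hu').2 (seqTo_ssubset_seqExt hG hI b).1

end Cuts

end ExtensiveGame

/-! ### Two auxiliary facts on finite families of reals. -/

section Sums

/-- A prescribed cumulative distribution is realized by increments that are constant on the
level sets. -/
lemma exists_increments {ι : Type*} (s : Finset ι) (L : ι → ℝ) (F : ℝ → ℝ) :
    ∃ τ : ι → ℝ, (∀ w ∈ s, ∑ v ∈ s with L v ≤ L w, τ v = F (L w)) ∧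
      ∀ w ∈ s, τ w * (s.filter fun v => L v = L w).card = F (L w) ∨
        ∃ v ∈ s, L v < L w ∧ τ w * (s.filter fun v => L v = L w).card = F (L w) - F (L v) := by
  classical
  -- `D t` is the jump of `F` from the preceding level to `t`; it is later shared equally among the
  -- elements at level `t`.
  have hD : ∀ t : ℝ, ∃ d : ℝ, ((∀ v ∈ s, t ≤ L v) ∧ d = F t) ∨
      ∃ v ∈ s, L v < t ∧ (∀ u ∈ s, L u < t → L u ≤ L v) ∧ d = F t - F (L v) := by
    intro t
    by_cases h : (s.filter fun v => L v < t).Nonempty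
    · obtain ⟨v, hv, hmax⟩ := Finset.exists_max_image _ L h
      obtain ⟨hv, hvt⟩ := Finset.mem_filter.1 hv
      exact ⟨_, Or.inr ⟨v, hv, hvt, fun u hu hut => hmax u (Finset.mem_filter.2 ⟨hu, hut⟩), rfl⟩⟩
    · refine ⟨_, Or.inl ⟨fun v hv => ?_, rfl⟩⟩
      by_contra hlt
      exact h ⟨v, Finset.mem_filter.2 ⟨hv, not_le.1 hlt⟩⟩
  choose D hD using hD
  have hcard : ∀ w ∈ s, ((s.filter fun v => L v = L w).card : ℝ) ≠ 0 := by
    intro w hw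
    exact Nat.cast_ne_zero.2 (Finset.card_ne_zero_of_mem (Finset.mem_filter.2 ⟨hw, rfl⟩))
  refine ⟨fun w => D (L w) / (s.filter fun v => L v = L w).card, fun w hw => ?_, fun w hw => ?_⟩
  · have hlevel : ∀ w ∈ s, ∑ v ∈ s with L v = L w,
        D (L v) / ((s.filter fun u => L u = L v).card : ℝ) = D (L w) := by
      intro w hw
      rw [Finset.sum_congr rfl fun v hv => by rw [(Finset.mem_filter.1 hv).2], Finset.sum_const,
        nsmul_eq_mul]
      exact mul_div_cancel₀ _ (hcard w hw)
    induction hn : (s.filter fun v => L v < L w).card using Nat.strong_induction_on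
      generalizing w with
    | _ n ih =>
      have hsplit : s.filter (fun v => L v ≤ L w) =
          s.filter (fun v => L v = L w) ∪ s.filter fun v => L v < L w := by
        ext v
        simp only [Finset.mem_filter, Finset.mem_union, le_iff_eq_or_lt]
        tauto
      rw [hsplit, Finset.sum_union, hlevel w hw]
      · rcases hD (L w) with ⟨h1, h2⟩ | ⟨u, hu, huw, hmax, h2⟩
        · have : s.filter (fun v => L v < L w) = ∅ :=
            Finset.filter_eq_empty_iff.2 fun v hv => not_lt.2 (h1 v hv)
          rw [this, Finset.sum_empty, add_zero, h2]
        · have : s.filter (fun v => L v < L w) = s.filter fun v => L v ≤ L u := by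
            refine Finset.filter_congr fun v hv => ⟨hmax v hv, fun h => h.trans_lt huw⟩
          rw [this, ih _ ?_ u hu rfl, h2]
          · ring
          · rw [← hn]
            refine Finset.card_lt_card (Finset.ssubset_iff_of_subset ?_ |>.2 ⟨u, ?_, ?_⟩)
            · intro v hv
              obtain ⟨hv, hvu⟩ := Finset.mem_filter.1 hv
              exact Finset.mem_filter.2 ⟨hv, hvu.trans huw⟩
            · exact Finset.mem_filter.2 ⟨hu, huw⟩
            · simp
      · refine Finset.disjoint_left.2 fun v hv hv' => ?_
        exact (Finset.mem_filter.1 hv').2.ne (Finset.mem_filter.1 hv).2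
  · beta_reduce
    rw [div_mul_cancel₀ _ (hcard w hw)]
    rcases hD (L w) with ⟨-, h2⟩ | ⟨u, hu, huw, -, h2⟩
    · exact Or.inl h2
    · exact Or.inr ⟨u, hu, huw, h2⟩

/-- Interpolation of a rapidly decreasing family by a sequence of geometric growth. -/
lemma exists_geometric_interpolation {T : Finset ℝ} {n : ℝ → ℕ} {X μ : ℝ → ℝ} {κ : ℕ} {θ : ℝ}
    (hθ : 0 < θ) (hθ1 : θ ≤ 1) (hn : StrictAntiOn n T) (hn0 : ∀ t ∈ T, 0 < n t)
    (hκ : ∃ t ∈ T, n t = κ) (hnκ : ∀ t ∈ T, n t ≤ κ) (hμ : ∀ t ∈ T, 0 < μ t)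
    (hμX : ∀ t ∈ T, μ t ≤ X t)
    (hX : ∀ t ∈ T, ∀ t' ∈ T, t < t' → X t' ≤ θ ^ (κ + 1) * μ t) :
    ∃ S : ℕ → ℝ, S 0 = 0 ∧ (∀ q, 0 < q → q ≤ κ → 0 < S q) ∧
      (∀ q, 0 < q → q < κ → S q ≤ θ * S (q + 1)) ∧
      ∀ t ∈ T, S (n t) = X t ∧ S (n t - 1) ≤ μ t := by
  classical
  -- As `n` is decreasing, the largest such level has the smallest prescribed index `n t ≥ q`. `S`
  -- takes the value `X t` there and decays geometrically from `μ t` below it.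
  have hlvl : ∀ q, ∃ t, q ≤ κ → t ∈ T ∧ q ≤ n t ∧ ∀ t' ∈ T, q ≤ n t' → t' ≤ t := by
    intro q
    by_cases hq : q ≤ κ
    · obtain ⟨t₀, ht₀, h⟩ := hκ
      obtain ⟨t, ht, hmax⟩ := Finset.exists_max_image (T.filter fun t => q ≤ n t) id
        ⟨t₀, Finset.mem_filter.2 ⟨ht₀, h ▸ hq⟩⟩
      obtain ⟨ht, hqt⟩ := Finset.mem_filter.1 ht
      exact ⟨t, fun _ => ⟨ht, hqt, fun t' ht' h' => hmax t' (Finset.mem_filter.2 ⟨ht', h'⟩)⟩⟩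
    · exact ⟨0, fun h => absurd h hq⟩
  choose lvl hlvl using hlvl
  set S : ℕ → ℝ := fun q => if q = 0 then 0 else
    if q = n (lvl q) then X (lvl q) else θ ^ (n (lvl q) - q) * μ (lvl q) with hS
  have hpow : ∀ k, θ ^ k ≤ 1 := fun k => pow_le_one₀ hθ.le hθ1
  have hSn : ∀ t ∈ T, S (n t) = X t := by
    intro t ht
    obtain ⟨h1, h2, h3⟩ := hlvl (n t) (hnκ t ht)
    have heq : lvl (n t) = t := by
      refine le_antisymm ?_ (h3 t ht le_rfl)
      by_contra hlt
      exact not_lt.2 h2 (hn ht h1 (not_le.1 hlt))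
    simp only [hS]
    rw [if_neg (hn0 t ht).ne', if_pos (by rw [heq]), heq]
  have hlow : ∀ q, 0 < q → q ≤ κ → θ ^ (n (lvl q) - q) * μ (lvl q) ≤ S q := by
    intro q hq hqκ
    simp only [hS]
    rw [if_neg hq.ne']
    split_ifs with h
    · rw [← h, Nat.sub_self, pow_zero, one_mul]
      exact hμX _ (hlvl q hqκ).1
    · exact le_rfl
  have heq : ∀ q, 0 < q → q < n (lvl q) → S q = θ ^ (n (lvl q) - q) * μ (lvl q) := by
    intro q hq h
    simp only [hS]
    rw [if_neg hq.ne', if_neg h.ne]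
  refine ⟨S, by simp [hS], fun q hq hqκ => ?_, fun q hq hqκ => ?_, fun t ht => ⟨hSn t ht, ?_⟩⟩
  · exact (mul_pos (pow_pos hθ _) (hμ _ (hlvl q hqκ).1)).trans_le (hlow q hq hqκ)
  · obtain ⟨h1, h2, h3⟩ := hlvl q hqκ.le
    obtain ⟨h1', h2', -⟩ := hlvl (q + 1) hqκ
    have hlow' := hlow (q + 1) q.succ_pos hqκ
    rcases (h3 _ h1' (Nat.le_of_succ_le h2')).eq_or_lt with h | h
    · rw [h] at hlow' h2'
      refine le_trans (le_of_eq ?_) (mul_le_mul_of_nonneg_left hlow' hθ.le)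
      rw [heq q hq h2', ← mul_assoc, ← pow_succ']
      congr 2
      omega
    · have h4 : n (lvl q) < n (lvl (q + 1)) := hn h1' h1 h
      have h5 : q = n (lvl q) := by
        -- When the level changes between `q` and `q + 1`, `q` is a prescribed index. The factor `θ
        -- ^ (κ + 1)` in `hX` covers the at most `κ` decay steps from the next index and one more.
        by_contra hne
        exact not_le.2 h ((hlvl (q + 1) hqκ).2.2 _ h1 (by omega))
      have h6 : S q = X (lvl q) := by
        have := hSn _ h1
        rwa [← h5] at this
      rw [h6]
      refine (hX _ h1' _ h1 h).trans
        (le_trans ?_ (mul_le_mul_of_nonneg_left hlow' hθ.le))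
      rw [← mul_assoc, ← pow_succ']
      refine mul_le_mul_of_nonneg_right (pow_le_pow_of_le_one hθ.le hθ1 ?_) (hμ _ h1').le
      have := hnκ _ h1'
      omega
  · by_cases h1 : n t = 1
    · simp only [h1, hS]
      simpa using (hμ t ht).le
    · have h0 := hn0 t ht
      have hκt := hnκ t ht
      obtain ⟨h2, h3, h4⟩ := hlvl (n t - 1) (by omega)
      rcases (h4 t ht (Nat.sub_le _ _)).eq_or_lt with h | h
      · rw [heq _ (by omega) (by rw [← h]; omega), ← h]
        exact mul_le_of_le_one_left (hμ t ht).le (hpow _)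
      · have h5 := hn ht h2 h
        have h6 : n t - 1 = n (lvl (n t - 1)) := by omega
        rw [h6, hSn _ h2]
        exact (hX _ ht _ h2 h).trans (mul_le_of_le_one_left (hμ t ht).le (hpow _))

end Sums

namespace ExtensiveGame

variable {N A : Type*} [DecidableEq N] [DecidableEq A] {G : ExtensiveGame N A} {i : N}

/-! ### The perturbations and their partial sums. -/

section Perturb

lemma perturb_pos {d : ℕ → ℝ} (hd : ∀ l ∈ Finset.Icc 1 (G.kappa i ∅), 0 < d l) (l : ℕ) :
    0 < G.perturb i d l :=
  Finset.prod_pos fun q hq => hd q (by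
    rw [Finset.mem_Icc] at hq ⊢
    exact ⟨hq.1, hq.2.trans (Nat.sub_le _ _)⟩)

lemma perturb_of_le {d : ℕ → ℝ} {l : ℕ} (hl : G.kappa i ∅ ≤ l) : G.perturb i d l = 1 := by
  simp [perturb, Nat.sub_eq_zero_of_le hl]

lemma perturb_succ {d : ℕ → ℝ} {l : ℕ} (hl : l < G.kappa i ∅) :
    G.perturb i d l = G.perturb i d (l + 1) * d (G.kappa i ∅ - l) := by
  obtain ⟨m, hm⟩ : ∃ m, G.kappa i ∅ - l = m + 1 := ⟨G.kappa i ∅ - l - 1, by omega⟩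
  have hm' : G.kappa i ∅ - (l + 1) = m := by omega
  rw [perturb, perturb, hm, hm', Finset.prod_Icc_succ_top (by omega)]

lemma perturb_le {d : ℕ → ℝ} {ε : ℝ}
    (hd : ∀ l ∈ Finset.Icc 1 (G.kappa i ∅), 0 < d l ∧ d l ≤ ε) {l : ℕ}
    (hl : l < G.kappa i ∅) : G.perturb i d l ≤ ε * G.perturb i d (l + 1) := by
  rw [perturb_succ hl, mul_comm]
  exact mul_le_mul_of_nonneg_right (hd _ (Finset.mem_Icc.2 ⟨by omega, Nat.sub_le _ _⟩)).2
    (perturb_pos (fun l hl => (hd l hl).1) _).le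

lemma perturb_le_one {d : ℕ → ℝ}
    (hd : ∀ l ∈ Finset.Icc 1 (G.kappa i ∅), 0 < d l ∧ d l ≤ 1) (l : ℕ) :
    G.perturb i d l ≤ 1 := by
  refine Finset.prod_le_one (fun q hq => ?_) fun q hq => ?_ <;> rw [Finset.mem_Icc] at hq
  · exact (hd q (Finset.mem_Icc.2 ⟨hq.1, hq.2.trans (Nat.sub_le _ _)⟩)).1.le
  · exact (hd q (Finset.mem_Icc.2 ⟨hq.1, hq.2.trans (Nat.sub_le _ _)⟩)).2

variable (G) in
/-- The lower bound for an admissible set of weight `q`. -/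
def perturbSum (i : N) (d : ℕ → ℝ) (q : ℕ) : ℝ := ∑ l ∈ Finset.Icc 1 q, G.perturb i d l

lemma perturbSum_mono {d : ℕ → ℝ} (hd : ∀ l ∈ Finset.Icc 1 (G.kappa i ∅), 0 < d l) :
    Monotone (G.perturbSum i d) := fun _ _ h =>
  Finset.sum_le_sum_of_subset_of_nonneg (Finset.Icc_subset_Icc_right h)
    fun l _ _ => (perturb_pos hd l).le

lemma perturbSum_succ (d : ℕ → ℝ) (q : ℕ) :
    G.perturbSum i d (q + 1) = G.perturbSum i d q + G.perturb i d (q + 1) :=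
  Finset.sum_Icc_succ_top (by omega) _

lemma perturbSum_zero (d : ℕ → ℝ) : G.perturbSum i d 0 = 0 := by simp [perturbSum]

/-- Comparison with a geometric series of ratio at most `1 / 2`: each bound is negligible against
the next perturbation. -/
lemma perturbSum_le {d : ℕ → ℝ} {ε : ℝ} (hε : ε ≤ 1 / 2)
    (hd : ∀ l ∈ Finset.Icc 1 (G.kappa i ∅), 0 < d l ∧ d l ≤ ε) {q : ℕ}
    (hq : q < G.kappa i ∅) : G.perturbSum i d q ≤ 2 * ε * G.perturb i d (q + 1) := by
  have hpos := perturb_pos (G := G) fun l hl => (hd l hl).1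
  have hε0 : 0 < ε := by
    have := hd 1 (Finset.mem_Icc.2 ⟨le_rfl, by omega⟩)
    exact this.1.trans_le this.2
  induction q with
  | zero =>
    rw [perturbSum_zero]
    have := hpos 1
    positivity
  | succ q ih =>
    have h1 := ih (by omega)
    have h2 := perturb_le hd hq
    have h3 := hpos (q + 1)
    rw [perturbSum_succ]
    nlinarith

lemma exists_perturb_eq {r : ℕ → ℝ} {ε : ℝ} (hε : 0 < ε)
    (hr : ∀ l ∈ Finset.Icc 1 (G.kappa i ∅), 0 < r l) (hr1 : r (G.kappa i ∅) = 1)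
    (hrε : ∀ l, 0 < l → l < G.kappa i ∅ → r l ≤ ε * r (l + 1)) :
    ∃ d : ℕ → ℝ, (∀ l ∈ Finset.Icc 1 (G.kappa i ∅), 0 < d l ∧ d l ≤ ε) ∧
      ∀ l ∈ Finset.Icc 1 (G.kappa i ∅), G.perturb i d l = r l := by
  set κ := G.kappa i ∅ with hκ
  -- Successive quotients. The entry at `κ` enters none of the products for `l ≥ 1`, so any
  -- admissible value will do.
  refine ⟨fun q => if q < κ then r (κ - q) / r (κ - q + 1) else ε, fun l hl => ?_,
    fun l hl => ?_⟩
  · obtain ⟨h1, h2⟩ := Finset.mem_Icc.1 hl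
    by_cases h : l < κ
    · have h3 := hr (κ - l) (Finset.mem_Icc.2 ⟨by omega, by omega⟩)
      have h4 := hr (κ - l + 1) (Finset.mem_Icc.2 ⟨by omega, by omega⟩)
      simp only [if_pos h]
      exact ⟨div_pos h3 h4, (div_le_iff₀ h4).2 (hrε _ (by omega) (by omega))⟩
    · simp only [if_neg h]
      exact ⟨hε, le_rfl⟩
  · obtain ⟨h1, h2⟩ := Finset.mem_Icc.1 hl
    induction h2 using Nat.decreasingInduction with
    | self => rw [hr1, perturb_of_le le_rfl]
    | of_succ l hlt ih =>
      have h4 := hr (l + 1) (Finset.mem_Icc.2 ⟨by omega, hlt⟩)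
      rw [perturb_succ (hκ ▸ hlt), ih (Finset.mem_Icc.2 ⟨by omega, hlt⟩) (by omega), ← hκ,
        if_pos (by omega)]
      have h5 : κ - (κ - l) = l := by omega
      rw [h5]
      exact mul_div_cancel₀ _ h4.ne'

end Perturb

end ExtensiveGame

/-! ### The two directions for a single player against fixed losses. -/

namespace ExtensiveGame

variable {N A : Type*} [DecidableEq N] [DecidableEq A] {G : ExtensiveGame N A} {i : N}
  {ℓ : Finset (List A) × A → ℝ}

/-- The expected loss is a positive combination of the probabilities of the cuts at the positive
loss levels. -/
lemma exists_cut_coefficients (hG : G.PerfectRecall) (hℓ : G.IsLoss i ℓ) :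
    ∃ c : ℝ → ℝ, (∀ w ∈ G.seqs (some i), 0 < lossOf ℓ w → 0 < c (lossOf ℓ w)) ∧ c 0 = 0 ∧
      (∀ w ∈ G.seqs (some i),
        ∑ t ∈ (G.seqs (some i)).image (lossOf ℓ) with t ≤ lossOf ℓ w, c t = lossOf ℓ w) ∧
      ∀ x : MoveSet A → ℝ, G.cost i ℓ x =
        ∑ t ∈ (G.seqs (some i)).image (lossOf ℓ), c t * ∑ w ∈ G.cut i ℓ t, x w := by
  -- With both functions the identity, the increments are the gaps between successive loss levels.
  obtain ⟨c, hc, hc'⟩ := exists_increments ((G.seqs (some i)).image (lossOf ℓ)) id id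
  simp only [id] at hc hc'
  have hsum : ∀ w ∈ G.seqs (some i),
      ∑ t ∈ (G.seqs (some i)).image (lossOf ℓ) with t ≤ lossOf ℓ w, c t = lossOf ℓ w :=
    fun w hw => hc _ (Finset.mem_image_of_mem _ hw)
  refine ⟨c, fun w hw hpos => ?_, ?_, hsum, cost_eq_sum_cut hG hℓ hsum⟩
  · have h : 0 < c (lossOf ℓ w) *
        (((G.seqs (some i)).image (lossOf ℓ)).filter fun v => v = lossOf ℓ w).card := by
      rcases hc' _ (Finset.mem_image_of_mem _ hw) with h | ⟨v, -, hv, h⟩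
      · rwa [h]
      · rw [h]
        exact sub_pos.2 hv
    exact pos_of_mul_pos_left h (Nat.cast_nonneg _)
  · have h := hsum ∅ empty_mem_seqs
    have h1 : ((G.seqs (some i)).image (lossOf ℓ)).filter (fun t => t ≤ lossOf ℓ ∅) = {0} := by
      refine Finset.eq_singleton_iff_unique_mem.2 ⟨?_, fun t ht => ?_⟩
      · exact Finset.mem_filter.2 ⟨Finset.mem_image.2 ⟨∅, empty_mem_seqs, lossOf_empty⟩,
          lossOf_empty.ge⟩
      · obtain ⟨ht, ht0⟩ := Finset.mem_filter.1 ht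
        obtain ⟨w, hw, rfl⟩ := Finset.mem_image.1 ht
        exact le_antisymm (lossOf_empty (ℓ := ℓ) ▸ ht0) (lossOf_nonneg hG hℓ hw)
    rwa [h1, Finset.sum_singleton, lossOf_empty] at h

/-- A positive plan whose probabilities decrease sharply with the loss is optimal in some
perturbed strategy space with small perturbations. -/
theorem exists_perturbation_of_ratio (hG : G.PerfectRecall) (i : N) {ε' : ℝ} (hε' : 0 < ε')
    (hε'1 : ε' ≤ 1) :
    ∃ ε > 0, ∀ ℓ, G.IsLoss i ℓ → ∀ x ∈ G.plans i, (∀ w ∈ G.seqs (some i), 0 < x w) →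
      (∀ v ∈ G.seqs (some i), ∀ w ∈ G.seqs (some i), lossOf ℓ w < lossOf ℓ v →
        x v ≤ ε * x w) →
      ∃ d : ℕ → ℝ, (∀ l ∈ Finset.Icc 1 (G.kappa i ∅), 0 < d l ∧ d l ≤ ε') ∧
        x ∈ G.perturbedPlans i d ∧ ∀ z ∈ G.perturbedPlans i d, G.cost i ℓ x ≤ G.cost i ℓ z := by
  classical
  set κ := G.kappa i ∅ with hκ
  set W := G.seqs (some i) with hW
  have hWpos : (0 : ℝ) < W.card :=
    Nat.cast_pos.2 (Finset.card_pos.2 ⟨∅, empty_mem_seqs⟩)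
  set θ := ε' / 2 with hθ
  have hθ0 : 0 < θ := half_pos hε'
  -- Chosen before `ℓ`, hence uniform in the opponents' plans. `W.card` pays for summing over a cut,
  -- `θ ^ (κ + 1)` for the interpolation.
  refine ⟨θ ^ (κ + 1) / W.card, div_pos (pow_pos hθ0 _) hWpos, fun ℓ hℓ x hx hpos hratio => ?_⟩
  have hmin : ∀ t : ℝ, ∃ w, t ∈ W.image (lossOf ℓ) →
      w ∈ W ∧ lossOf ℓ w = t ∧ ∀ v ∈ W, lossOf ℓ v = t → x w ≤ x v := by
    intro t
    by_cases ht : t ∈ W.image (lossOf ℓ)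
    · obtain ⟨w, hw, hwt⟩ := Finset.mem_image.1 ht
      obtain ⟨u, hu, hmin⟩ := Finset.exists_min_image (W.filter fun w => lossOf ℓ w = t) x
        ⟨w, Finset.mem_filter.2 ⟨hw, hwt⟩⟩
      obtain ⟨hu, hut⟩ := Finset.mem_filter.1 hu
      exact ⟨u, fun _ => ⟨hu, hut, fun v hv hvt => hmin v (Finset.mem_filter.2 ⟨hv, hvt⟩)⟩⟩
    · exact ⟨∅, fun h => absurd h ht⟩
  choose m hm using hmin
  have h0 : (0 : ℝ) ∈ W.image (lossOf ℓ) :=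
    Finset.mem_image.2 ⟨∅, empty_mem_seqs, lossOf_empty⟩
  obtain ⟨S, hS0, hSpos, hSθ, hST⟩ := exists_geometric_interpolation
    (T := W.image (lossOf ℓ)) (n := fun t => G.weight i (G.cut i ℓ t))
    (X := fun t => ∑ u ∈ G.cut i ℓ t, x u) (μ := fun t => x (m t)) (κ := κ) hθ0
    (by linarith)
    (by
      intro t ht t' ht' hlt
      obtain ⟨v, hv, rfl⟩ := Finset.mem_image.1 ht
      obtain ⟨w, hw, rfl⟩ := Finset.mem_image.1 ht'
      exact weight_cut_strictAnti hG hℓ hv hw hlt)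
    (by
      intro t ht
      obtain ⟨v, hv, rfl⟩ := Finset.mem_image.1 ht
      exact weight_cut_pos hv)
    ⟨0, h0, weight_cut_zero⟩
    (by
      intro t ht
      obtain ⟨v, hv, rfl⟩ := Finset.mem_image.1 ht
      exact weight_cut_le_kappa hG hℓ hv)
    (fun t ht => hpos _ (hm t ht).1)
    (fun t ht => le_sum_cut hG hx (hm t ht).1 (hm t ht).2.1.ge)
    (by
      intro t ht t' ht' hlt
      calc ∑ u ∈ G.cut i ℓ t', x u
          ≤ ∑ u ∈ G.cut i ℓ t', θ ^ (κ + 1) / W.card * x (m t) := by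
            refine Finset.sum_le_sum fun u hu => hratio u (cut_subset t' hu) _ (hm t ht).1 ?_
            rw [(hm t ht).2.1]
            exact hlt.trans_le (le_lossOf_of_mem_cut hu)
        _ ≤ W.card * (θ ^ (κ + 1) / W.card * x (m t)) := by
            rw [Finset.sum_const, nsmul_eq_mul]
            refine mul_le_mul_of_nonneg_right
              (Nat.cast_le.2 (Finset.card_le_card (cut_subset t'))) ?_
            exact mul_nonneg (div_nonneg (pow_nonneg hθ0.le _) hWpos.le)
              (hpos _ (hm t ht).1).le
        _ = θ ^ (κ + 1) * x (m t) := by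
            field_simp)
  have hSκ : S κ = 1 := by
    have h := (hST 0 h0).1
    rwa [weight_cut_zero, cut_zero, Finset.sum_singleton, hx.1] at h
  -- Here `θ = ε' / 2` matters: the ratio must survive passing from partial sums to differences.
  have hstep : ∀ l, 0 < l → l < κ → S l ≤ ε' * (S (l + 1) - S l) := by
    intro l hl0 hl
    have h1 := hSθ l hl0 hl
    have h2 := hSpos l hl0 hl.le
    have h3 := hSpos (l + 1) (by omega) hl
    nlinarith
  have hdiff : ∀ l, l < κ → 0 < S (l + 1) - S l := by
    intro l hl
    rcases Nat.eq_zero_or_pos l with rfl | hl0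
    · rw [hS0, sub_zero]
      exact hSpos 1 one_pos hl
    · have h1 := hstep l hl0 hl
      have h2 := hSpos l hl0 hl.le
      exact pos_of_mul_pos_right (h2.trans_le h1) hε'.le
  obtain ⟨d, hd, hdr⟩ := exists_perturb_eq (G := G) (i := i)
    -- At `κ` the perturbation is an empty product, so it is `1` and not a difference; this is
    -- harmless since admissible weights are below `κ`.
    (r := fun l => if l < κ then S l - S (l - 1) else 1) (ε := ε') hε' (by
      intro l hl
      obtain ⟨h1, h2⟩ := Finset.mem_Icc.1 hl
      by_cases h : l < κ
      · have h3 := hdiff (l - 1) (by omega)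
        rw [Nat.sub_add_cancel h1] at h3
        simpa only [if_pos h] using h3
      · simp only [if_neg h, zero_lt_one]) (by simp [hκ]) (by
      intro l hl0 hl
      have hSl : S l - S (l - 1) ≤ S l := by
        rcases Nat.eq_zero_or_pos (l - 1) with h | h
        · rw [h, hS0, sub_zero]
        · exact sub_le_self _ (hSpos _ h (by omega)).le
      have hl' : l < κ := hl
      simp only [if_pos hl']
      split_ifs with h
      · exact hSl.trans (hstep l hl0 hl)
      · have h1 : l + 1 = κ := by omega
        have h2 := hstep l hl0 hl
        have h3 := hSpos l hl0 hl.le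
        rw [h1, hSκ] at h2
        nlinarith)
  have hsum : ∀ q, q < κ → G.perturbSum i d q = S q := by
    intro q
    induction q with
    | zero => exact fun _ => by rw [perturbSum_zero, hS0]
    | succ q ih =>
      intro hq
      rw [perturbSum_succ, ih (by omega), hdr _ (Finset.mem_Icc.2 ⟨by omega, hq.le⟩), if_pos hq,
        Nat.add_sub_cancel]
      ring
  have hlt : ∀ w ∈ W, 0 < lossOf ℓ w → G.weight i (G.cut i ℓ (lossOf ℓ w)) < κ :=
    fun w hw h => (cut_admissible hG hℓ h hw le_rfl).weight_lt_kappa hG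
  refine ⟨d, hd, ⟨hx, fun E hE => ?_⟩, fun z hz => ?_⟩
  · refine le_sum_of_le_sum_cut hG hℓ hx (perturbSum_mono fun l hl => (hd l hl).1)
      (fun w hw => ?_) (fun w hw h => ?_) hE
    · have h1 := weight_cut_le_kappa hG hℓ hw
      have h2 := weight_cut_pos (ℓ := ℓ) hw
      have h3 := Finset.mem_image_of_mem (lossOf ℓ) hw
      rw [hsum _ (by omega)]
      exact (hST _ h3).2.trans ((hm _ h3).2.2 w hw rfl)
    · rw [hsum _ (hlt w hw h)]
      exact (hST _ (Finset.mem_image_of_mem _ hw)).1.le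
  · obtain ⟨c, hcpos, hc0, -, hcost⟩ := exists_cut_coefficients hG hℓ
    rw [hcost, hcost]
    refine Finset.sum_le_sum fun t ht => ?_
    obtain ⟨w, hw, rfl⟩ := Finset.mem_image.1 ht
    rcases (lossOf_nonneg hG hℓ hw).eq_or_lt with h | h
    · rw [← h, hc0, zero_mul, zero_mul]
    · refine mul_le_mul_of_nonneg_left ?_ (hcpos w hw h).le
      rw [← (hST _ ht).1, ← hsum _ (hlt w hw h)]
      exact hz.2 _ (cut_admissible hG hℓ h hw le_rfl)

lemma plans_convex_combination {s : Finset (MoveSet A)} {τ : MoveSet A → ℝ}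
    (hτ : ∀ v ∈ s, 0 ≤ τ v) (hτ1 : ∑ v ∈ s, τ v = 1) {e : MoveSet A → MoveSet A → ℝ}
    (he : ∀ v ∈ s, e v ∈ G.plans i) : (fun w => ∑ v ∈ s, τ v * e v w) ∈ G.plans i := by
  refine ⟨?_, fun I hI => ?_, fun I hI a ha => ?_, fun w hw => ?_⟩
  · beta_reduce
    rw [← hτ1]
    exact Finset.sum_congr rfl fun v hv => by rw [(he v hv).1, mul_one]
  · beta_reduce
    rw [Finset.sum_comm]
    refine Finset.sum_congr rfl fun v hv => ?_
    rw [← Finset.mul_sum, (he v hv).2.1 I hI]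
  · exact Finset.sum_nonneg fun v hv => mul_nonneg (hτ v hv) ((he v hv).2.2.1 I hI a ha)
  · exact Finset.sum_eq_zero fun v hv => by rw [(he v hv).2.2.2 w hw, mul_zero]

/-- In an optimal plan of a slightly perturbed strategy space, all constraints given by cuts
are binding. -/
theorem sum_cut_eq_of_optimal (hG : G.PerfectRecall) (hℓ : G.IsLoss i ℓ) {ε : ℝ}
    (hε : ε ≤ 1 / 4 / (G.seqs (some i)).card) {d : ℕ → ℝ}
    (hd : ∀ l ∈ Finset.Icc 1 (G.kappa i ∅), 0 < d l ∧ d l ≤ ε) {x : MoveSet A → ℝ}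
    (hx : x ∈ G.perturbedPlans i d)
    (hopt : ∀ z ∈ G.perturbedPlans i d, G.cost i ℓ x ≤ G.cost i ℓ z)
    {w : MoveSet A} (hw : w ∈ G.seqs (some i)) (hpos : 0 < lossOf ℓ w) :
    ∑ u ∈ G.cut i ℓ (lossOf ℓ w), x u =
      G.perturbSum i d (G.weight i (G.cut i ℓ (lossOf ℓ w))) := by
  classical
  set κ := G.kappa i ∅ with hκ
  set W := G.seqs (some i) with hW
  have hW1 : (1 : ℝ) ≤ W.card :=
    Nat.one_le_cast.2 (Finset.card_pos.2 ⟨∅, empty_mem_seqs⟩)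
  have hεW : ε * W.card ≤ 1 / 4 := (le_div_iff₀ (by linarith)).1 hε
  have hε0 : 0 < ε := by
    have := hd 1 (Finset.mem_Icc.2 ⟨le_rfl, kappa_pos _⟩)
    exact this.1.trans_le this.2
  have hε4 : ε ≤ 1 / 4 := by nlinarith
  have hd0 : ∀ l ∈ Finset.Icc 1 κ, 0 < d l := fun l hl => (hd l hl).1
  have hrpos := perturb_pos hd0
  set n : ℝ → ℕ := fun t => G.weight i (G.cut i ℓ t) with hn
  -- The target probabilities of the cuts. At level `0` the cut is `{∅}`, of probability `1`.
  set F : ℝ → ℝ := fun t => if n t < κ then G.perturbSum i d (n t) else 1 with hF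
  have hnpos : ∀ v ∈ W, 0 < n (lossOf ℓ v) := fun v hv => weight_cut_pos hv
  have hnκ : ∀ v ∈ W, n (lossOf ℓ v) ≤ κ := fun v hv => weight_cut_le_kappa hG hℓ hv
  have hpred : ∀ v ∈ W, G.perturbSum i d (n (lossOf ℓ v) - 1) ≤
      2 * ε * G.perturb i d (n (lossOf ℓ v)) := by
    intro v hv
    have h1 := hnpos v hv
    have h2 := hnκ v hv
    have h3 := perturbSum_le (G := G) (i := i) (q := n (lossOf ℓ v) - 1) (by linarith) hd (by omega)
    rwa [Nat.sub_add_cancel h1] at h3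
  -- the gap of `F` below a level
  have hgap : ∀ v ∈ W, G.perturb i d (n (lossOf ℓ v)) / 2 ≤
      F (lossOf ℓ v) - G.perturbSum i d (n (lossOf ℓ v) - 1) := by
    intro v hv
    have h1 := hpred v hv
    have h2 := hrpos (n (lossOf ℓ v))
    simp only [hF]
    split_ifs with h
    · have h3 := perturbSum_succ (G := G) (i := i) d (n (lossOf ℓ v) - 1)
      rw [Nat.sub_add_cancel (hnpos v hv)] at h3
      linarith
    · rw [perturb_of_le (not_lt.1 h)] at h1 ⊢
      nlinarith
  -- Signs are reversed so that the total mass of `τ` on losses at least `t` is `F t`.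
  obtain ⟨τ, hτ, hτ'⟩ := exists_increments W (fun v => -lossOf ℓ v) fun t => F (-t)
  simp only [neg_neg, neg_le_neg_iff, neg_lt_neg_iff, neg_inj] at hτ hτ'
  -- A jump of `F` is at least `r_n / 2` and is shared by at most `W.card` sequences, while `S(n -
  -- 1) ≤ 2 ε r_n`; this is what `ε ≤ 1 / 4 / W.card` is for.
  have hτlow : ∀ v ∈ W, G.perturbSum i d (n (lossOf ℓ v) - 1) ≤ τ v := by
    intro v hv
    have h1 : G.perturb i d (n (lossOf ℓ v)) / 2 ≤
        τ v * (W.filter fun u => lossOf ℓ u = lossOf ℓ v).card := by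
      have h2 := hgap v hv
      have h3 : 0 ≤ G.perturbSum i d (n (lossOf ℓ v) - 1) :=
        Finset.sum_nonneg fun l _ => (hrpos l).le
      rcases hτ' v hv with h | ⟨u, hu, huv, h⟩
      · rw [h]
        linarith
      · have h4 : n (lossOf ℓ u) < n (lossOf ℓ v) := weight_cut_strictAnti hG hℓ hv hu huv
        have h5 : F (lossOf ℓ u) = G.perturbSum i d (n (lossOf ℓ u)) :=
          if_pos (h4.trans_le (hnκ v hv))
        rw [h, h5]
        have h6 := perturbSum_mono hd0 (Nat.le_sub_one_of_lt h4)
        linarith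
    have h2 := hrpos (n (lossOf ℓ v))
    have h3 : ((W.filter fun u => lossOf ℓ u = lossOf ℓ v).card : ℝ) ≤ W.card :=
      Nat.cast_le.2 (Finset.card_le_card (Finset.filter_subset _ _))
    have h4 : 0 < τ v := pos_of_mul_pos_left (lt_of_lt_of_le (by linarith) h1) (Nat.cast_nonneg _)
    have h5 : G.perturb i d (n (lossOf ℓ v)) / 2 ≤ τ v * W.card :=
      h1.trans (mul_le_mul_of_nonneg_left h3 h4.le)
    have h6 := hpred v hv
    have h7 : G.perturbSum i d (n (lossOf ℓ v) - 1) ≤ 2 * ε * (2 * (τ v * W.card)) :=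
      h6.trans (mul_le_mul_of_nonneg_left (by linarith) (by linarith))
    have h8 : 2 * ε * (2 * (τ v * W.card)) = 4 * (ε * W.card) * τ v := by ring
    rw [h8] at h7
    exact h7.trans (mul_le_of_le_one_left h4.le (by linarith))
  have hτ0 : ∀ v ∈ W, 0 ≤ τ v := fun v hv =>
    le_trans (Finset.sum_nonneg fun l _ => (hrpos l).le) (hτlow v hv)
  have hτ1 : ∑ v ∈ W, τ v = 1 := by
    have h1 := hτ ∅ empty_mem_seqs
    rw [lossOf_empty, Finset.filter_true_of_mem fun v hv => lossOf_nonneg hG hℓ hv] at h1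
    rw [h1]
    exact if_neg (by simp only [hn, weight_cut_zero]; exact lt_irrefl _)
  choose! e he1 he2 he3 using fun v (hv : v ∈ W) => exists_plan_cost_eq hG hℓ hv
  -- Since `e v` incurs exactly the loss of `v`, this mixture costs `∑ c_t F(t)`, the least value
  -- the cut constraints permit.
  set y : MoveSet A → ℝ := fun w => ∑ v ∈ W, τ v * e v w with hy
  have hyp : y ∈ G.plans i := plans_convex_combination hτ0 hτ1 he1
  have hFt : ∀ v ∈ W, 0 < lossOf ℓ v →
      F (lossOf ℓ v) = G.perturbSum i d (n (lossOf ℓ v)) := fun v hv h =>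
    if_pos ((cut_admissible hG hℓ h hv le_rfl).weight_lt_kappa hG)
  have hyF : ∀ v ∈ W, F (lossOf ℓ v) ≤ ∑ u ∈ G.cut i ℓ (lossOf ℓ v), y u := by
    intro v hv
    rw [← hτ v hv]
    simp only [hy]
    rw [Finset.sum_comm]
    refine (Finset.sum_le_sum fun u hu => ?_).trans (Finset.sum_le_sum_of_subset_of_nonneg
      (Finset.filter_subset _ _) fun u hu _ => ?_)
    · obtain ⟨hu, huv⟩ := Finset.mem_filter.1 hu
      rw [← Finset.mul_sum]
      refine le_mul_of_one_le_right (hτ0 u hu) ?_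
      rw [← he2 u hu]
      exact le_sum_cut hG (he1 u hu) hu huv
    · exact Finset.sum_nonneg fun u' _ =>
        mul_nonneg (hτ0 u hu) (plan_nonneg hG (he1 u hu) _)
  have hymem : y ∈ G.perturbedPlans i d := by
    refine ⟨hyp, fun E hE => le_sum_of_le_sum_cut hG hℓ hyp (perturbSum_mono hd0)
      (fun v hv => (hτlow v hv).trans ?_) (fun v hv h => ?_) hE⟩
    · have h1 : τ v * e v v ≤ y v := Finset.single_le_sum (f := fun u => τ u * e u v)
        (fun u hu => mul_nonneg (hτ0 u hu) (plan_nonneg hG (he1 u hu) _)) hv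
      rwa [he2 v hv, mul_one] at h1
    · exact (hFt v hv h).symm.le.trans (hyF v hv)
  obtain ⟨c, hcpos, hc0, hcsum, hcost⟩ := exists_cut_coefficients hG hℓ
  have hycost : G.cost i ℓ y = ∑ t ∈ W.image (lossOf ℓ), c t * F t := by
    have h1 : G.cost i ℓ y = ∑ v ∈ W, τ v * lossOf ℓ v := by
      simp only [cost, hy, Finset.sum_mul]
      rw [Finset.sum_comm]
      refine Finset.sum_congr rfl fun v hv => ?_
      rw [← he3 v hv, cost, Finset.mul_sum]
      exact Finset.sum_congr rfl fun m _ => mul_assoc _ _ _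
    have h2 : ∀ v ∈ W, τ v * lossOf ℓ v =
        ∑ t ∈ W.image (lossOf ℓ), if t ≤ lossOf ℓ v then c t * τ v else 0 := by
      intro v hv
      rw [← Finset.sum_filter, ← Finset.sum_mul, hcsum v hv, mul_comm]
    rw [h1, Finset.sum_congr rfl h2, Finset.sum_comm]
    refine Finset.sum_congr rfl fun t ht => ?_
    obtain ⟨v, hv, rfl⟩ := Finset.mem_image.1 ht
    rw [← hτ v hv, Finset.mul_sum, Finset.sum_filter]
  have hle : ∀ t ∈ W.image (lossOf ℓ), c t * F t ≤ c t * ∑ u ∈ G.cut i ℓ t, x u := by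
    intro t ht
    obtain ⟨v, hv, rfl⟩ := Finset.mem_image.1 ht
    rcases (lossOf_nonneg hG hℓ hv).eq_or_lt with h | h
    · rw [← h, hc0, zero_mul, zero_mul]
    · refine mul_le_mul_of_nonneg_left ?_ (hcpos v hv h).le
      rw [hFt v hv h]
      exact hx.2 _ (cut_admissible hG hℓ h hv le_rfl)
  have heq : ∑ t ∈ W.image (lossOf ℓ), c t * F t =
      ∑ t ∈ W.image (lossOf ℓ), c t * ∑ u ∈ G.cut i ℓ t, x u :=
    le_antisymm (Finset.sum_le_sum hle) (by rw [← hycost, ← hcost]; exact hopt y hymem)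
  -- Termwise inequalities with equal sums are equalities, and the coefficient at a positive level
  -- can be cancelled.
  have h1 := (Finset.sum_eq_sum_iff_of_le hle).1 heq _ (Finset.mem_image_of_mem _ hw)
  rw [← mul_left_cancel₀ (hcpos w hw hpos).ne' h1, hFt w hw hpos]

/-- An optimal plan of a slightly perturbed strategy space has probabilities that decrease
sharply with the loss. -/
theorem ratio_of_optimal (hG : G.PerfectRecall) (hℓ : G.IsLoss i ℓ) {ε : ℝ}
    (hε : ε ≤ 1 / 4 / (G.seqs (some i)).card) {d : ℕ → ℝ}
    (hd : ∀ l ∈ Finset.Icc 1 (G.kappa i ∅), 0 < d l ∧ d l ≤ ε) {x : MoveSet A → ℝ}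
    (hx : x ∈ G.perturbedPlans i d)
    (hopt : ∀ z ∈ G.perturbedPlans i d, G.cost i ℓ x ≤ G.cost i ℓ z)
    {v w : MoveSet A} (hv : v ∈ G.seqs (some i)) (hw : w ∈ G.seqs (some i))
    (hwv : lossOf ℓ w < lossOf ℓ v) : x v ≤ 4 * ε * x w := by
  have hW1 : (1 : ℝ) ≤ (G.seqs (some i)).card :=
    Nat.one_le_cast.2 (Finset.card_pos.2 ⟨∅, empty_mem_seqs⟩)
  have hεW := (le_div_iff₀ (by linarith)).1 hε
  have hε0 : 0 < ε := by
    have := hd 1 (Finset.mem_Icc.2 ⟨le_rfl, kappa_pos _⟩)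
    exact this.1.trans_le this.2
  have hε4 : ε ≤ 1 / 4 := by nlinarith
  have hd0 : ∀ l ∈ Finset.Icc 1 (G.kappa i ∅), 0 < d l := fun l hl => (hd l hl).1
  have hpos : 0 < lossOf ℓ v := (lossOf_nonneg hG hℓ hw).trans_lt hwv
  have hcut := sum_cut_eq_of_optimal hG hℓ hε hd hx hopt hv hpos
  have hadm := cut_admissible hG hℓ hpos hv le_rfl
  set n := G.weight i (G.cut i ℓ (lossOf ℓ v)) with hn
  have h1 : x v ≤ 2 * ε * G.perturb i d (n + 1) :=
    ((le_sum_cut hG hx.1 hv le_rfl).trans hcut.le).trans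
      (perturbSum_le (by linarith) hd (hadm.weight_lt_kappa hG))
  have h2 := le_add_sum_cut hG hℓ hx.1 hpos hv le_rfl
    (perturb_le_one (fun l hl => ⟨(hd l hl).1, (hd l hl).2.trans (by linarith)⟩) (n + 1))
    (fun E hE hlt => by
      refine le_trans ?_ ((perturbSum_mono hd0 (Nat.succ_le_of_lt hlt)).trans (hx.2 E hE))
      rw [Nat.succ_eq_add_one, perturbSum_succ]
      exact le_add_of_nonneg_left (Finset.sum_nonneg fun l _ => (perturb_pos hd0 l).le)) hw hwv
  have h3 : ∑ u ∈ G.cut i ℓ (lossOf ℓ v) with ¬ w ⊆ u, x u ≤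
      ∑ u ∈ G.cut i ℓ (lossOf ℓ v), x u :=
    Finset.sum_le_sum_of_subset_of_nonneg (Finset.filter_subset _ _)
      fun u _ _ => plan_nonneg hG hx.1 u
  have h4 := perturbSum_le (by linarith) hd (hadm.weight_lt_kappa hG)
  have h5 := perturb_pos hd0 (n + 1)
  rw [hcut] at h3
  -- From `r_{n+1} ≤ x w + S(n)` and `S(n) ≤ 2 ε r_{n+1} ≤ r_{n+1} / 2`.
  have h6 : G.perturb i d (n + 1) / 2 ≤ x w := by nlinarith
  nlinarith

end ExtensiveGame

/-! ### Passage to profiles and to limits. -/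

namespace ExtensiveGame

variable {N A : Type*} [Fintype N] [DecidableEq N] [DecidableEq A] {G : ExtensiveGame N A}

lemma eventually_perturbed_of_ratio (hG : G.PerfectRecall) {ε' : ℝ} (hε' : 0 < ε') :
    ∀ᶠ ε in 𝓝 (0 : ℝ), ∀ γ, G.IsEpsProperRatio ε γ → G.IsEpsProperPerturbed ε' γ := by
  choose e he0 he using fun i => exists_perturbation_of_ratio hG i (lt_min hε' one_pos)
    (min_le_right ε' 1)
  have hall : ∀ᶠ ε in 𝓝 (0 : ℝ), ∀ i, ε ≤ e i :=
    eventually_all.2 fun i => eventually_le_nhds (he0 i)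
  filter_upwards [hall] with ε hε γ hγ
  obtain ⟨hγp, hpos, hratio⟩ := hγ
  have hd : ∀ i, ∃ d : ℕ → ℝ,
      (∀ l ∈ Finset.Icc 1 (G.kappa i ∅), 0 < d l ∧ d l ≤ min ε' 1) ∧
      γ i ∈ G.perturbedPlans i d ∧
      ∀ z ∈ G.perturbedPlans i d, G.objective i z γ ≤ G.objective i (γ i) γ := by
    intro i
    obtain ⟨ℓ, hℓ, K, K', hobj, hmax⟩ := exists_loss_payoff hG i γ
    obtain ⟨d, hd, hmem, hopt⟩ := he i ℓ hℓ (γ i) (hγp i) (hpos i) fun v hv w hw hlt => by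
      refine (hratio i v hv w hw ?_).trans
        (mul_le_mul_of_nonneg_right (hε i) (hpos i w hw).le)
      rw [hmax v hv, hmax w hw]
      linarith
    refine ⟨d, hd, hmem, fun z hz => ?_⟩
    rw [hobj z hz.1, hobj _ hmem.1]
    linarith [hopt z hz]
  choose d hd hmem hopt using hd
  exact ⟨hγp, hpos, d, fun i l hl => ⟨(hd i l hl).1, (hd i l hl).2.trans (min_le_left _ _)⟩,
    fun i => ⟨hmem i, hopt i⟩⟩

lemma eventually_ratio_of_perturbed (hG : G.PerfectRecall) {ε' : ℝ} (hε' : 0 < ε') :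
    ∀ᶠ ε in 𝓝 (0 : ℝ), ∀ γ, G.IsEpsProperPerturbed ε γ → G.IsEpsProperRatio ε' γ := by
  have h1 : ∀ᶠ ε : ℝ in 𝓝 0, ∀ i : N, ε ≤ 1 / 4 / (G.seqs (some i)).card := by
    refine eventually_all.2 fun i => eventually_le_nhds ?_
    have : (0 : ℝ) < (G.seqs (some i)).card :=
      Nat.cast_pos.2 (Finset.card_pos.2 ⟨∅, empty_mem_seqs⟩)
    positivity
  have h2 : ∀ᶠ ε in 𝓝 (0 : ℝ), ε ≤ ε' / 4 :=
    eventually_le_nhds (by positivity)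
  filter_upwards [h1, h2] with ε hε hεε' γ hγ
  obtain ⟨hγp, hpos, d, hd, hnash⟩ := hγ
  refine ⟨hγp, hpos, fun i v hv w hw hlt => ?_⟩
  obtain ⟨ℓ, hℓ, K, K', hobj, hmax⟩ := exists_loss_payoff hG i γ
  obtain ⟨hmem, hopt⟩ := hnash i
  have h3 := ratio_of_optimal hG hℓ (hε i) (hd i) hmem (fun z hz => by
    have := hopt z hz
    rw [hobj z hz.1, hobj _ hmem.1] at this
    linarith) hv hw (by
    rw [hmax v hv, hmax w hw] at hlt
    linarith)
  exact h3.trans (mul_le_mul_of_nonneg_right (by linarith) (hpos i w hw).le)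

/-- Plans vanish off the finite set of sequences, so only finitely many coordinates per player
matter for convergence in the product topology. -/
lemma tendsto_of_forall_seqs {N A : Type*} [DecidableEq N] [DecidableEq A]
    {G : ExtensiveGame N A} {γ : PlanProfile N A} (hγ : γ ∈ G.planProfiles)
    {η : ℕ → PlanProfile N A} (hη : ∀ k, η k ∈ G.planProfiles)
    (h : ∀ k : ℕ, ∀ i, ∀ w ∈ G.seqs (some i), |η k i w - γ i w| < 1 / ((k : ℝ) + 1)) :
    Tendsto η atTop (𝓝 γ) := by
  refine tendsto_pi_nhds.2 fun i => tendsto_pi_nhds.2 fun w => ?_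
  by_cases hw : w ∈ G.seqs (some i)
  · refine tendsto_iff_norm_sub_tendsto_zero.2 (squeeze_zero (fun _ => norm_nonneg _)
      (fun k => (h k i w hw).le) tendsto_one_div_add_atTop_nhds_zero_nat)
  · simp only [(hη _ i).2.2.2 w hw, (hγ i).2.2.2 w hw]
    exact tendsto_const_nhds

end ExtensiveGame

end

theorem theorem3 {N A : Type*} [Fintype N] [DecidableEq N] [DecidableEq A]
    (G : ExtensiveGame N A) (hG : G.PerfectRecall) (γ : PlanProfile N A) :
    G.IsProperRatio γ ↔ G.IsProperPerturbed γ := by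
  have hone : ∀ m : ℕ, (0 : ℝ) < 1 / ((m : ℝ) + 1) := fun m => Nat.one_div_pos_of_nat
  constructor
  · rintro ⟨hγ, ε, η, -, hε, hη, hcl⟩
    -- The profile space may have infinitely many coordinates, so a convergent subsequence is
    -- extracted by closeness on the sequences alone, together with the perturbed property for `1 /
    -- (m + 1)`.
    have hfreq : ∀ m : ℕ, ∃ᶠ k in atTop,
        (∀ i, ∀ w ∈ G.seqs (some i), |η k i w - γ i w| < 1 / ((m : ℝ) + 1)) ∧
          G.IsEpsProperPerturbed (1 / ((m : ℝ) + 1)) (η k) := by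
      intro m
      have hnear : ∀ᶠ ζ : PlanProfile N A in 𝓝 γ,
          ∀ i, ∀ w ∈ G.seqs (some i), |ζ i w - γ i w| < 1 / ((m : ℝ) + 1) := by
        refine eventually_all.2 fun i => (Finset.eventually_all _).2 fun w _ => ?_
        have hcont : Continuous fun ζ : PlanProfile N A => |ζ i w - γ i w| := by fun_prop
        exact hcont.continuousAt.eventually_lt continuousAt_const (by simpa using hone m)
      refine (mapClusterPt_iff_frequently.1 hcl _ hnear).and_eventually ?_
      filter_upwards [hε.eventually (ExtensiveGame.eventually_perturbed_of_ratio hG (hone m))]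
        with k hk
      exact hk _ (hη k)
    obtain ⟨φ, -, hφ⟩ := extraction_forall_of_frequently hfreq
    exact ⟨hγ, fun m => 1 / ((m : ℝ) + 1), fun m => η (φ m), hone,
      tendsto_one_div_add_atTop_nhds_zero_nat, fun m => (hφ m).2,
      ExtensiveGame.tendsto_of_forall_seqs hγ (fun m => (hη _).1) fun m => (hφ m).1⟩
  · rintro ⟨hγ, ε, η, -, hε, hη, hlim⟩
    have hev : ∀ m : ℕ, ∀ᶠ k in atTop, G.IsEpsProperRatio (1 / ((m : ℝ) + 1)) (η k) := by
      intro m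
      filter_upwards [hε.eventually (ExtensiveGame.eventually_ratio_of_perturbed hG (hone m))]
        with k hk
      exact hk _ (hη k)
    obtain ⟨φ, hmono, hφ⟩ := extraction_forall_of_eventually hev
    exact ⟨hγ, fun m => 1 / ((m : ℝ) + 1), fun m => η (φ m), hone,
      tendsto_one_div_add_atTop_nhds_zero_nat, hφ,
      (hlim.comp hmono.tendsto_atTop).mapClusterPt⟩
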